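/- Let $\alpha\ge 1$ be real. The $\alpha$-Grushin plane $\mathbb G_\alpha$ is the sub-Riemannian structure on $\mathbb R^2$ generated by the vector fields $\partial_x$ and $|x|^\alpha\partial_y$. Its Hamiltonian is $$H(x,y,u,v)=\tfrac12\bigl(u^2+v^2|x|^{2\alpha}\bigr),$$ where $(u,v)$ stands for the covector $u\,dx+v\,dy$ at $(x,y)$. For $q\in\mathbb R^2$ let $\exp_q$ be the sub-Riemannian exponential map at $q$: it sends $\lambda_0\in T^*_q\mathbb R^2$ to the projection on $\mathbb R^2$ of the value at time $1$ of the solution of Hamilton's equations with initial value $(q,\lambda_0)$. Let $$\mathrm{Conj}^*_q(\mathbb G_\alpha)=\{\lambda_0\in T_q^*\mathbb R^2 : \ker(d_{\lambda_0}\exp_q)\neq\{0\},\ H(q,\lambda_0)\neq0\}$$ be the set of non-trivial conjugate covectors at $q$. (The condition $H(q,\lambda_0)\ne 0$ says that the geodesic is not constant; it excludes a conjugate covector only if $q$ lies on the line $x=0$.) **Theorem.** For every real $\alpha\ge1$ and every $q\in\mathbb R^2$ there is a non-empty subset $C^0$ of $\mathrm{Conj}^*_q(\mathbb G_\alpha)$,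 open and dense in $\mathrm{Conj}^*_q(\mathbb G_\alpha)$, such that for every $\lambda_0\in C^0$: 1. $\lambda_0$ is a Whitney fold singularity of $\exp_q$. That is, there is an open neighbourhood $U$ of $\lambda_0$ on which $\exp_q$ is $C^\infty$, on which $0$ is a regular value of $\lambda\mapsto\det(d_\lambda\exp_q)$ and on which $\dim\ker(d_\lambda\exp_q)=1$ at every singularity $\lambda$ of $\exp_q$ (a point with $\ker(d_{\lambda}\exp_q)\neq\{0\}$); and, $S$ being the curve of singularities of $\exp_q$ in $U$, one has $T_{\lambda_0}S\cap\ker(d_{\lambda_0}\exp_q)=\{0\}$. 2. In the neighbourhood of $\lambda_0$, $\exp_q$ is equivalent to $(x,y)\mapsto(x^2,y)$. That is, there are a $C^\infty$ chart centered at $\lambda_0$ and a $C^\infty$ chart centered at $\exp_q(\lambda_0)$ in which $\exp_q$ is represented by $(x,y)\mapsto(x^2,y)$. -/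

import Mathlib

open scoped ContDiff

namespace SubRiem

/-! ### Sub-Riemannian structures on the plane

The plane is `ℝ × ℝ` with coordinates `(x, y)`. The covector `u dx + v dy` at a point is written
`(u, v) : ℝ × ℝ`, and the cotangent bundle is `(ℝ × ℝ) × (ℝ × ℝ)`, whose points are `(q, p)` with
base point `q` and covector `p`. A sub-Riemannian structure is given by a finite family of global
vector fields `X : Fin m → ℝ × ℝ → ℝ × ℝ`. -/

/-- The pairing of the covector `p = u dx + v dy` with the tangent vector `w`. -/
def pairing (p w : ℝ × ℝ) : ℝ := p.1 * w.1 + p.2 * w.2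

/-- The sub-Riemannian Hamiltonian `H(q, p) = (1/2) ∑ₖ ⟨p, Xₖ(q)⟩²`. -/
noncomputable def hamiltonian {m : ℕ} (X : Fin m → ℝ × ℝ → ℝ × ℝ)
    (z : (ℝ × ℝ) × (ℝ × ℝ)) : ℝ :=
  (1 / 2) * ∑ k, (pairing z.2 (X k z.1)) ^ 2

/-- The Hamiltonian vector field of a function `a` on the cotangent bundle for the canonical
symplectic structure: `(∂a/∂u, ∂a/∂v)` in the directions of the base and `(-∂a/∂x, -∂a/∂y)` in the
directions of the fibre. -/
noncomputable def hamiltonianVectorField (a : (ℝ × ℝ) × (ℝ × ℝ) → ℝ)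
    (z : (ℝ × ℝ) × (ℝ × ℝ)) : (ℝ × ℝ) × (ℝ × ℝ) :=
  ((fderiv ℝ a z ((0, 0), (1, 0)), fderiv ℝ a z ((0, 0), (0, 1))),
    (-fderiv ℝ a z ((1, 0), (0, 0)), -fderiv ℝ a z ((0, 1), (0, 0))))

/-- `l` is, on the whole interval `[0, 1]`, a solution of the Hamilton equation. -/
def IsNormalExtremal {m : ℕ} (X : Fin m → ℝ × ℝ → ℝ × ℝ)
    (l : ℝ → (ℝ × ℝ) × (ℝ × ℝ)) : Prop :=
  ∀ t ∈ Set.Icc (0 : ℝ) 1,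
    HasDerivWithinAt l (hamiltonianVectorField (hamiltonian X) (l t)) (Set.Icc (0 : ℝ) 1) t

/-- The set of covectors `p` at `q` such that the solution of the Hamilton equation with initial
value `(q, p)` is defined on the whole interval `[0, 1]`. -/
def expDomain {m : ℕ} (X : Fin m → ℝ × ℝ → ℝ × ℝ) (q : ℝ × ℝ) : Set (ℝ × ℝ) :=
  {p | ∃ l : ℝ → (ℝ × ℝ) × (ℝ × ℝ), IsNormalExtremal X l ∧ l 0 = (q, p)}

open Classical in
/-- The sub-Riemannian exponential map at `q`: the projection to the plane of the time-one value of
the solution of the Hamilton equation with initial value `(q, p)`. (The value outside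
`expDomain X q` is a placeholder.) -/
noncomputable def expMap {m : ℕ} (X : Fin m → ℝ × ℝ → ℝ × ℝ) (q p : ℝ × ℝ) : ℝ × ℝ :=
  if h : p ∈ expDomain X q then (h.choose 1).1 else q

/-- The set of singularities of a map of the plane into itself. -/
def singularSet (f : ℝ × ℝ → ℝ × ℝ) : Set (ℝ × ℝ) :=
  {p | LinearMap.ker (fderiv ℝ f p : ℝ × ℝ →ₗ[ℝ] ℝ × ℝ) ≠ ⊥}

/-- The conjugate locus at `q`, a set of covectors at `q`. -/
def conjugateLocus {m : ℕ} (X : Fin m → ℝ × ℝ → ℝ × ℝ) (q : ℝ × ℝ) : Set (ℝ × ℝ) :=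
  expDomain X q ∩ singularSet (expMap X q)

/-- The conjugate covectors at `q` with `H ≠ 0`, that is, those whose normal geodesic is not
constant. -/
def nontrivialConjugateLocus {m : ℕ} (X : Fin m → ℝ × ℝ → ℝ × ℝ) (q : ℝ × ℝ) : Set (ℝ × ℝ) :=
  {p | p ∈ conjugateLocus X q ∧ hamiltonian X (q, p) ≠ 0}

/-- The generating vector fields `∂_x` and `|x|^α ∂_y` of the `α`-Grushin plane. -/
noncomputable def grushin (α : ℝ) : Fin 2 → ℝ × ℝ → ℝ × ℝ :=
  ![fun _ => (1, 0), fun q => (0, |q.1| ^ α)]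

/-! ### Whitney folds -/

/-- The vectors tangent at `p` to a (smooth, embedded) submanifold `S` of the plane: velocities
of smooth curves in `S` passing through `p`. -/
def tangentVectors (S : Set (ℝ × ℝ)) (p : ℝ × ℝ) : Set (ℝ × ℝ) :=
  {w | ∃ (c : ℝ → ℝ × ℝ) (ε : ℝ), 0 < ε ∧ ContDiffOn ℝ ∞ c (Set.Ioo (-ε) ε) ∧
    (∀ t ∈ Set.Ioo (-ε) ε, c t ∈ S) ∧ c 0 = p ∧ HasDerivAt c w 0}

/-- `p` is a good singularity of `f`, as witnessed by its open neighbourhood `U`: `f` is smooth on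
`U`, zero is a regular value of `x ↦ det (d_x f)` on `U`, and the kernel of the differential is
one-dimensional at every singularity in `U`. -/
def IsGoodSingularityOn (f : ℝ × ℝ → ℝ × ℝ) (p : ℝ × ℝ) (U : Set (ℝ × ℝ)) : Prop :=
  IsOpen U ∧ p ∈ U ∧ p ∈ singularSet f ∧ ContDiffOn ℝ ∞ f U ∧
  (∀ x ∈ U, (fderiv ℝ f x).det = 0 →
    Function.Surjective (fderiv ℝ (fun z => (fderiv ℝ f z).det) x)) ∧
  (∀ x ∈ singularSet f ∩ U,
    Module.finrank ℝ (LinearMap.ker (fderiv ℝ f x : ℝ × ℝ →ₗ[ℝ] ℝ × ℝ)) = 1)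

/-- `p` is a (Whitney) fold singularity of `f`: a good singularity at which the kernel of the
differential is transversal to the curve of singularities. -/
def IsFoldSingularity (f : ℝ × ℝ → ℝ × ℝ) (p : ℝ × ℝ) : Prop :=
  ∃ U : Set (ℝ × ℝ), IsGoodSingularityOn f p U ∧
    tangentVectors (singularSet f ∩ U) p ∩
      (LinearMap.ker (fderiv ℝ f p : ℝ × ℝ →ₗ[ℝ] ℝ × ℝ) : Set (ℝ × ℝ)) = {0}

/-- `φ` is a smooth coordinate chart of the plane centered at `p`. -/
def IsSmoothChartCenteredAt (φ : OpenPartialHomeomorph (ℝ × ℝ) (ℝ × ℝ)) (p : ℝ × ℝ) : Prop :=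
  p ∈ φ.source ∧ φ p = 0 ∧ ContDiffOn ℝ ∞ φ φ.source ∧ ContDiffOn ℝ ∞ φ.symm φ.target

/-- In the neighbourhood of `p`, the map `f` is equivalent to the map `g` near the origin: for
some smooth chart `φ` centered at `p` and some smooth chart `ψ` centered at `f p`, the
representation of `f` in these charts is `g`. -/
def IsEquivalentNear (f : ℝ × ℝ → ℝ × ℝ) (p : ℝ × ℝ) (g : ℝ × ℝ → ℝ × ℝ) : Prop :=
  ∃ φ ψ : OpenPartialHomeomorph (ℝ × ℝ) (ℝ × ℝ),
    IsSmoothChartCenteredAt φ p ∧ IsSmoothChartCenteredAt ψ (f p) ∧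
    Set.MapsTo f φ.source ψ.source ∧ ∀ z ∈ φ.source, ψ (f z) = g (φ z)

end SubRiem

/-!
The Hamilton equations of the `α`-Grushin plane conserve `v` and reduce to the planar system
`X' = U`, `U' = -α v² |X|^(2α-2) X`, together with `Y' = v |X|^(2α)` (`IsSolution`). They are
invariant under affine changes of time and under the dilations of the plane
(`IsSolution.rescale`). Hence a single solution gives a two-parameter family of solutions with the
same initial point: a time shift composed with the dilation which restores the abscissa, and a
change of the time scale. When `v ≠ 0` and `H ≠ 0` this family provides coordinates on the
covectors (`covector`), in which the exponential map is explicit in terms of the solution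
(`endpoint`). This replaces the differentiability of the flow with respect to the initial
conditions, which is delicate because `|x|^(2α-2) x` is only of class `C¹`; the exponential map is
smooth near a covector whose geodesic does not end on the line `x = 0`. With the conservation of
energy and the integrated Euler relation (`IsSolution.displacement`), one finds
`α v² det(d exp) = U(0) X(1) - U(1) (X(0) + U(0))` (`IsSolution.hasFDerivAt_expMap`).

At a conjugate covector, the kernel of the differential is known explicitly. If `U(0) ≠ 0` and
`X(1) ≠ 0`, the derivative of the determinant in its direction does not vanish: otherwise
`|x|^(2α) x / u³` would take the same value at both ends of the geodesic, and this function of the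
state determines `x / u` at a given energy, whereas `X(1) / U(1) - X(0) / U(0) = 1` by conjugacy
(`IsSolution.foldCriterion`). This is the infinitesimal criterion for a Whitney fold. The normal
form `(x², y)` then follows from the Morse lemma with a parameter, itself a consequence of
Hadamard's lemma (`FoldCriterion.isFoldSingularity`, `FoldCriterion.isEquivalentNear`).

It remains to see that the conjugate covectors with `U(0) ≠ 0` and `X(1) ≠ 0` are dense. From a
point of the line `x = 0` there are no others. From any other point, the determinant changes sign
in the time scale at an exceptional covector, so that it also vanishes for the time shifts nearby,
at covectors which are not exceptional (`IsSolution.frequently_mem_of_eq_zero`). Covectors with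
`v = 0`, which these coordinates do not reach, are not conjugate unless `H = 0`, by an estimate of
the exponential map to the first order (`det_fderiv_expMap_ne_zero`). Conjugate covectors exist by
the symmetries of periodic solutions (`nonempty_nontrivialConjugateLocus`).
-/

namespace Grushin

open Set Filter Topology Metric

/-! ### Smooth germs and division by a coordinate -/

/-- Smoothness of the germ of `f` at `p`: unlike `ContDiffAt ℝ ∞ f p`, it provides a single
neighbourhood of `p` on which `f` is of class `C^∞`. -/
def SmoothNear {E F : Type*} [NormedAddCommGroup E] [NormedSpace ℝ E] [NormedAddCommGroup F]
    [NormedSpace ℝ F] (f : E → F) (p : E) : Prop :=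
  ∀ᶠ z in 𝓝 p, ContDiffAt ℝ ∞ f z

section SmoothNear

variable {E F G : Type*} [NormedAddCommGroup E] [NormedSpace ℝ E] [NormedAddCommGroup F]
  [NormedSpace ℝ F] [NormedAddCommGroup G] [NormedSpace ℝ G]

theorem smoothNear_of_contDiff {f : E → F} (hf : ContDiff ℝ ∞ f) (p : E) : SmoothNear f p :=
  Eventually.of_forall fun _ => hf.contDiffAt

theorem SmoothNear.contDiffAt {f : E → F} {p : E} (hf : SmoothNear f p) : ContDiffAt ℝ ∞ f p :=
  hf.self_of_nhds

theorem SmoothNear.differentiableAt {f : E → F} {p : E} (hf : SmoothNear f p) :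
    DifferentiableAt ℝ f p :=
  hf.contDiffAt.differentiableAt (by simp)

theorem SmoothNear.eventually_differentiableAt {f : E → F} {p : E} (hf : SmoothNear f p) :
    ∀ᶠ z in 𝓝 p, DifferentiableAt ℝ f z :=
  hf.mono fun _ h => h.differentiableAt (by simp)

theorem SmoothNear.continuousAt {f : E → F} {p : E} (hf : SmoothNear f p) : ContinuousAt f p :=
  hf.contDiffAt.continuousAt

theorem SmoothNear.comp {g : F → G} {f : E → F} {p : E} (hg : SmoothNear g (f p))
    (hf : SmoothNear f p) : SmoothNear (fun z => g (f z)) p := by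
  filter_upwards [hf.continuousAt.eventually hg, hf] with z h1 h2
  exact h1.comp z h2

theorem SmoothNear.comp_of_eq {g : F → G} {f : E → F} {p : E} {q : F} (hg : SmoothNear g q)
    (hf : SmoothNear f p) (h : f p = q) : SmoothNear (fun z => g (f z)) p := by
  subst h
  exact hg.comp hf

theorem SmoothNear.congr {f g : E → F} {p : E} (hf : SmoothNear f p) (h : g =ᶠ[𝓝 p] f) :
    SmoothNear g p := by
  filter_upwards [hf, h.eventually_nhds] with z h1 h2
  exact h1.congr_of_eventuallyEq h2

theorem SmoothNear.smoothNear_fderiv {f : E → F} {p : E} (hf : SmoothNear f p) :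
    SmoothNear (fderiv ℝ f) p :=
  hf.mono fun _ h => h.fderiv_right (m := ∞) (by simp)

theorem SmoothNear.fderiv_apply {f : E → F} {p : E} (hf : SmoothNear f p) (v : E) :
    SmoothNear (fun z => fderiv ℝ f z v) p :=
  hf.smoothNear_fderiv.mono fun _ h => h.clm_apply contDiffAt_const

theorem SmoothNear.prodMk {f : E → F} {g : E → G} {p : E} (hf : SmoothNear f p)
    (hg : SmoothNear g p) : SmoothNear (fun z => (f z, g z)) p := by
  filter_upwards [hf, hg] with z h1 h2
  exact h1.prodMk h2

theorem SmoothNear.add {f g : E → F} {p : E} (hf : SmoothNear f p) (hg : SmoothNear g p) :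
    SmoothNear (fun z => f z + g z) p := by
  filter_upwards [hf, hg] with z h1 h2
  exact h1.add h2

theorem SmoothNear.sub {f g : E → F} {p : E} (hf : SmoothNear f p) (hg : SmoothNear g p) :
    SmoothNear (fun z => f z - g z) p := by
  filter_upwards [hf, hg] with z h1 h2
  exact h1.sub h2

theorem SmoothNear.mul {f g : E → ℝ} {p : E} (hf : SmoothNear f p) (hg : SmoothNear g p) :
    SmoothNear (fun z => f z * g z) p := by
  filter_upwards [hf, hg] with z h1 h2
  exact h1.mul h2

theorem smoothNear_const (c : F) (p : E) : SmoothNear (fun _ : E => c) p :=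
  smoothNear_of_contDiff contDiff_const p

theorem smoothNear_fst (p : E × F) : SmoothNear (fun z : E × F => z.1) p :=
  smoothNear_of_contDiff contDiff_fst p

theorem smoothNear_snd (p : E × F) : SmoothNear (fun z : E × F => z.2) p :=
  smoothNear_of_contDiff contDiff_snd p

theorem SmoothNear.exists_isOpen {f : E → F} {p : E} (hf : SmoothNear f p) {P : E → Prop}
    (hP : ∀ᶠ z in 𝓝 p, P z) :
    ∃ U : Set E, IsOpen U ∧ p ∈ U ∧ ContDiffOn ℝ ∞ f U ∧ ∀ z ∈ U, P z := by
  obtain ⟨U, hU, hUo, hpU⟩ := _root_.eventually_nhds_iff.1 (hf.and hP)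
  exact ⟨U, hUo, hpU, fun z hz => (hU z hz).1.contDiffWithinAt, fun z hz => (hU z hz).2⟩

end SmoothNear

/-- A smooth germ extends to a globally smooth function, by means of a bump function. -/
theorem SmoothNear.exists_contDiff {E : Type*} [NormedAddCommGroup E] [NormedSpace ℝ E]
    [FiniteDimensional ℝ E] {f : E → ℝ} {p : E} (hf : SmoothNear f p) :
    ∃ g : E → ℝ, ContDiff ℝ ∞ g ∧ g =ᶠ[𝓝 p] f := by
  obtain ⟨r, hr, hball⟩ := Metric.eventually_nhds_iff_ball.1 hf
  let χ : ContDiffBump p := ⟨r / 4, r / 2, by positivity, by linarith⟩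
  refine ⟨fun z => χ z * f z, ?_, ?_⟩
  · rw [contDiff_iff_contDiffAt]
    intro z
    by_cases hz : z ∈ ball p r
    · exact χ.contDiff.contDiffAt.mul (hball z hz)
    · have hz' : z ∉ tsupport χ := by
        rw [χ.tsupport_eq]
        simp only [mem_ball, not_lt, mem_closedBall, not_le] at hz ⊢
        change r / 2 < dist z p
        linarith
      have : (fun z => χ z * f z) =ᶠ[𝓝 z] fun _ => 0 := by
        filter_upwards [notMem_tsupport_iff_eventuallyEq.1 hz'] with y hy
        simp [hy]
      exact contDiffAt_const.congr_of_eventuallyEq this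
  · filter_upwards [χ.eventuallyEq_one] with z hz
    simp [hz]

theorem hasFDerivAt_parametric_integral {E G : Type*} [NormedAddCommGroup E] [NormedSpace ℝ E]
    [FiniteDimensional ℝ E] [NormedAddCommGroup G] [NormedSpace ℝ G] [CompleteSpace G]
    {F : ℝ × E → G} (hF : ContDiff ℝ 1 F) (x : E) :
    HasFDerivAt (fun x => ∫ t in (0 : ℝ)..1, F (t, x))
      (∫ t in (0 : ℝ)..1, (fderiv ℝ F (t, x)).comp (ContinuousLinearMap.inr ℝ ℝ E)) x := by
  have hF' : Continuous fun z : ℝ × E => (fderiv ℝ F z).comp (ContinuousLinearMap.inr ℝ ℝ E) :=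
    (hF.continuous_fderiv (by simp)).clm_comp continuous_const
  obtain ⟨C, hC⟩ := ((isCompact_Icc (a := (0 : ℝ)) (b := 1)).prod
    (isCompact_closedBall x 1)).exists_bound_of_continuousOn hF'.continuousOn
  refine intervalIntegral.hasFDerivAt_integral_of_dominated_of_fderiv_le
    (F' := fun x t => (fderiv ℝ F (t, x)).comp (ContinuousLinearMap.inr ℝ ℝ E))
    (bound := fun _ => C) (closedBall_mem_nhds x one_pos) ?_ ?_ ?_ ?_ ?_ ?_
  · exact Eventually.of_forall fun y => (by
      have : Continuous fun t : ℝ => F (t, y) := hF.continuous.comp (by fun_prop)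
      exact this.aestronglyMeasurable)
  · have : Continuous fun t : ℝ => F (t, x) := hF.continuous.comp (by fun_prop)
    exact this.intervalIntegrable _ _
  · have : Continuous fun t : ℝ => (fderiv ℝ F (t, x)).comp (ContinuousLinearMap.inr ℝ ℝ E) :=
      hF'.comp (f := fun t : ℝ => (t, x)) (by fun_prop)
    exact this.aestronglyMeasurable
  · refine Eventually.of_forall fun t ht y hy => hC (t, y) ⟨?_, hy⟩
    rw [uIoc_of_le zero_le_one] at ht
    exact ⟨ht.1.le, ht.2⟩
  · exact intervalIntegrable_const
  · refine Eventually.of_forall fun t _ y _ => ?_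
    have h1 : HasFDerivAt F (fderiv ℝ F (t, y)) (t, y) :=
      (hF.differentiable (by simp) _).hasFDerivAt
    exact h1.comp y (hasFDerivAt_prodMk_right t y)

/-- Integrals of smooth functions over a compact interval depend smoothly on parameters. The target
`G` is quantified inside the statement because the derivative of the integral is an integral of
linear maps with values in `G`; for the same reason `E` and `G` share a universe. -/
theorem contDiff_parametric_integral {E : Type} [NormedAddCommGroup E] [NormedSpace ℝ E]
    [FiniteDimensional ℝ E] (n : ℕ) : ∀ {G : Type} [NormedAddCommGroup G] [NormedSpace ℝ G]
    [CompleteSpace G] {F : ℝ × E → G}, ContDiff ℝ ∞ F →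
    ContDiff ℝ n (fun x => ∫ t in (0 : ℝ)..1, F (t, x)) := by
  induction n with
  | zero =>
    intro G _ _ _ F hF
    have : Differentiable ℝ (fun x => ∫ t in (0 : ℝ)..1, F (t, x)) := fun x =>
      (hasFDerivAt_parametric_integral (hF.of_le (by simp)) x).differentiableAt
    exact contDiff_zero.2 this.continuous
  | succ n ih =>
    intro G _ _ _ F hF
    have h1 := hasFDerivAt_parametric_integral (F := F) (hF.of_le (by simp))
    push_cast
    rw [contDiff_succ_iff_fderiv]
    refine ⟨fun x => (h1 x).differentiableAt, by simp, ?_⟩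
    have h2 : fderiv ℝ (fun x => ∫ t in (0 : ℝ)..1, F (t, x)) = fun x =>
        ∫ t in (0 : ℝ)..1, (fderiv ℝ F (t, x)).comp (ContinuousLinearMap.inr ℝ ℝ E) :=
      funext fun x => (h1 x).fderiv
    rw [h2]
    exact ih (F := fun z => (fderiv ℝ F z).comp (ContinuousLinearMap.inr ℝ ℝ E))
      ((hF.fderiv_right (m := ∞) (by simp)).clm_comp contDiff_const)

/-- Hadamard's lemma: a smooth germ vanishing on the line `s = 0` is divisible by `s`. -/
theorem SmoothNear.exists_eq_fst_mul {f : ℝ × ℝ → ℝ} (hf : SmoothNear f 0)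
    (h0 : ∀ᶠ t in 𝓝 (0 : ℝ), f (0, t) = 0) :
    ∃ g : ℝ × ℝ → ℝ, SmoothNear g 0 ∧ ∀ᶠ z in 𝓝 (0 : ℝ × ℝ), f z = z.1 * g z := by
  obtain ⟨F, hF, hFf⟩ := hf.exists_contDiff
  let D : ℝ × (ℝ × ℝ) → ℝ := fun w => fderiv ℝ F (w.1 * w.2.1, w.2.2) (1, 0)
  have hD : ContDiff ℝ ∞ D :=
    ((hF.fderiv_right (m := ∞) (by simp)).comp (by fun_prop)).clm_apply contDiff_const
  refine ⟨fun z => ∫ t in (0 : ℝ)..1, D (t, z),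
    smoothNear_of_contDiff (contDiff_infty.2 fun n => contDiff_parametric_integral n hD) 0, ?_⟩
  have h0' : ∀ᶠ z in 𝓝 (0 : ℝ × ℝ), F (0, z.2) = 0 := by
    have hc : Tendsto (fun z : ℝ × ℝ => z.2) (𝓝 0) (𝓝 0) := continuous_snd.tendsto 0
    have hc' : Tendsto (fun z : ℝ × ℝ => ((0 : ℝ), z.2)) (𝓝 0) (𝓝 0) := by
      have : Continuous (fun z : ℝ × ℝ => ((0 : ℝ), z.2)) := by fun_prop
      exact this.tendsto 0
    filter_upwards [hc.eventually h0, hc'.eventually hFf] with z h1 h2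
    rw [h2, h1]
  filter_upwards [hFf, h0'] with z h1 h2
  have hderiv : ∀ t : ℝ, HasDerivAt (fun t : ℝ => F (t * z.1, z.2)) (z.1 * D (t, z)) t := by
    intro t
    have h3 : HasDerivAt (fun t : ℝ => (t * z.1, z.2)) (z.1, 0) t := by
      simpa using ((hasDerivAt_id t).mul_const z.1).prodMk (hasDerivAt_const t z.2)
    have h4 := ((hF.differentiable (by simp) (t * z.1, z.2)).hasFDerivAt).comp_hasDerivAt t h3
    have h5 : ((z.1, 0) : ℝ × ℝ) = z.1 • (1, 0) := by simp
    rw [h5, map_smul, smul_eq_mul] at h4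
    exact h4
  have hcont : Continuous fun t : ℝ => z.1 * D (t, z) :=
    continuous_const.mul (hD.continuous.comp (by fun_prop))
  have hint := intervalIntegral.integral_eq_sub_of_hasDerivAt (a := 0) (b := 1)
    (fun t _ => hderiv t) (hcont.intervalIntegrable _ _)
  rw [intervalIntegral.integral_const_mul] at hint
  simp only [one_mul, zero_mul, h2, sub_zero] at hint
  rw [← h1]
  exact hint.symm

/-! ### Determinants and local diffeomorphisms of the plane -/

theorem det_eq (L : ℝ × ℝ →L[ℝ] ℝ × ℝ) :
    L.det = (L (1, 0)).1 * (L (0, 1)).2 - (L (0, 1)).1 * (L (1, 0)).2 := by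
  change LinearMap.det (L : ℝ × ℝ →ₗ[ℝ] ℝ × ℝ) = _
  rw [← LinearMap.det_toMatrix (Module.Basis.finTwoProd ℝ), Matrix.det_fin_two]
  simp [LinearMap.toMatrix_apply]

theorem apply_eq {F : Type*} [NormedAddCommGroup F] [NormedSpace ℝ F] (L : ℝ × ℝ →L[ℝ] F)
    (h : ℝ × ℝ) : L h = h.1 • L (1, 0) + h.2 • L (0, 1) := by
  conv_lhs => rw [show h = h.1 • ((1, 0) : ℝ × ℝ) + h.2 • ((0, 1) : ℝ × ℝ) by ext <;> simp]
  rw [map_add, map_smul, map_smul]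

theorem ker_ne_bot_iff (L : ℝ × ℝ →L[ℝ] ℝ × ℝ) :
    LinearMap.ker (L : ℝ × ℝ →ₗ[ℝ] ℝ × ℝ) ≠ ⊥ ↔ L.det = 0 := by
  change _ ↔ LinearMap.det (L : ℝ × ℝ →ₗ[ℝ] ℝ × ℝ) = 0
  refine ⟨fun h => ?_, fun h => bot_lt_iff_ne_bot.1 (LinearMap.bot_lt_ker_of_det_eq_zero h)⟩
  by_contra hd
  exact h (LinearMap.ker_eq_bot.2 (LinearMap.equivOfDetNeZero _ hd).injective)

theorem mem_singularSet_iff {f : ℝ × ℝ → ℝ × ℝ} {p : ℝ × ℝ} :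
    p ∈ SubRiem.singularSet f ↔ (fderiv ℝ f p).det = 0 :=
  ker_ne_bot_iff _

theorem exists_equiv_of_det_ne_zero {L : ℝ × ℝ →L[ℝ] ℝ × ℝ} (h : L.det ≠ 0) :
    ∃ e : (ℝ × ℝ) ≃L[ℝ] (ℝ × ℝ), (e : ℝ × ℝ →L[ℝ] ℝ × ℝ) = L :=
  ⟨L.toContinuousLinearEquivOfDetNeZero h, by ext <;> simp⟩

theorem SmoothNear.det_fderiv {f : ℝ × ℝ → ℝ × ℝ} {p : ℝ × ℝ} (hf : SmoothNear f p) :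
    SmoothNear (fun z => (fderiv ℝ f z).det) p := by
  simp only [det_eq]
  have h1 := hf.fderiv_apply (1, 0)
  have h2 := hf.fderiv_apply (0, 1)
  exact (((smoothNear_fst _).comp h1).mul ((smoothNear_snd _).comp h2)).sub
    (((smoothNear_fst _).comp h2).mul ((smoothNear_snd _).comp h1))

/-- The inverse function theorem in the smooth category, with the inverse smooth on its whole
domain, and the domain as small as desired. -/
theorem SmoothNear.exists_openPartialHomeomorph {f : ℝ × ℝ → ℝ × ℝ} {p : ℝ × ℝ}
    (hf : SmoothNear f p) (hd : (fderiv ℝ f p).det ≠ 0) {P : ℝ × ℝ → Prop}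
    (hP : ∀ᶠ z in 𝓝 p, P z) :
    ∃ φ : OpenPartialHomeomorph (ℝ × ℝ) (ℝ × ℝ), p ∈ φ.source ∧ (∀ z, φ z = f z) ∧
      (∀ z ∈ φ.source, P z) ∧ ContDiffOn ℝ ∞ φ φ.source ∧ ContDiffOn ℝ ∞ φ.symm φ.target := by
  obtain ⟨e, he⟩ := exists_equiv_of_det_ne_zero hd
  have hfe : HasFDerivAt f (e : ℝ × ℝ →L[ℝ] ℝ × ℝ) p := by
    rw [he]
    exact hf.differentiableAt.hasFDerivAt
  have hdn : ∀ᶠ z in 𝓝 p, (fderiv ℝ f z).det ≠ 0 :=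
    hf.det_fderiv.continuousAt.eventually_ne hd
  obtain ⟨U, hU, hpU, hfU, hUP⟩ := hf.exists_isOpen (hP.and hdn)
  let φ₀ := hf.contDiffAt.toOpenPartialHomeomorph f hfe (by simp)
  let φ := φ₀.restrOpen U hU
  have hφf : ∀ z, φ z = f z := fun z => rfl
  have hsrc : φ.source ⊆ U := by
    rw [φ₀.restrOpen_source]
    exact inter_subset_right
  refine ⟨φ, ?_, hφf, fun z hz => (hUP z (hsrc hz)).1, hfU.mono hsrc, ?_⟩
  · rw [φ₀.restrOpen_source]
    exact ⟨hf.contDiffAt.mem_toOpenPartialHomeomorph_source hfe (by simp), hpU⟩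
  · intro w hw
    have hz : φ.symm w ∈ U := hsrc (φ.map_target hw)
    obtain ⟨e', he'⟩ := exists_equiv_of_det_ne_zero (hUP _ hz).2
    have hc : ContDiffAt ℝ ∞ f (φ.symm w) := hfU.contDiffAt (hU.mem_nhds hz)
    refine (φ.contDiffAt_symm (f₀' := e') hw ?_ hc).contDiffWithinAt
    rw [he']
    exact (hc.differentiableAt (by simp)).hasFDerivAt

/-- A smooth local diffeomorphism has a smooth local inverse. -/
theorem SmoothNear.exists_local_inverse {f : ℝ × ℝ → ℝ × ℝ} {p : ℝ × ℝ} (hf : SmoothNear f p)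
    (hd : (fderiv ℝ f p).det ≠ 0) :
    ∃ g : ℝ × ℝ → ℝ × ℝ, SmoothNear g (f p) ∧ g (f p) = p ∧ (∀ᶠ w in 𝓝 (f p), f (g w) = w) ∧
      ∀ᶠ z in 𝓝 p, g (f z) = z := by
  obtain ⟨φ, hp, hφ, -, -, hs⟩ := hf.exists_openPartialHomeomorph hd (P := fun _ => True) (by simp)
  have ht : φ.target ∈ 𝓝 (f p) := by
    rw [← hφ]
    exact φ.open_target.mem_nhds (φ.map_source hp)
  refine ⟨φ.symm, ?_, ?_, ?_, ?_⟩
  · filter_upwards [eventually_mem_nhds_iff.2 ht] with w hw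
    exact hs.contDiffAt hw
  · rw [← hφ]
    exact φ.left_inv hp
  · filter_upwards [ht] with w hw
    rw [← hφ]
    exact φ.right_inv hw
  · filter_upwards [φ.open_source.mem_nhds hp] with z hz
    rw [← hφ]
    exact φ.left_inv hz

/-! ### The Morse lemma with a parameter -/

theorem hasDerivAt_fst_of_differentiableAt {f : ℝ × ℝ → ℝ} {z : ℝ × ℝ}
    (hf : DifferentiableAt ℝ f z) :
    HasDerivAt (fun s => f (s, z.2)) (fderiv ℝ f z (1, 0)) z.1 :=
  hf.hasFDerivAt.comp_hasDerivAt (f := fun s => (s, z.2)) z.1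
    ((hasDerivAt_id z.1).prodMk (hasDerivAt_const z.1 z.2))

theorem tendsto_zero_prodMk_nhds : Tendsto (fun t : ℝ => ((0 : ℝ), t)) (𝓝 0) (𝓝 0) := by
  have : Continuous fun t : ℝ => ((0 : ℝ), t) := by fun_prop
  exact this.tendsto 0

/-- If `f = s * g` with `g` smooth, then `∂_s f = g` on the line `s = 0`. -/
theorem fderiv_eq_of_eq_fst_mul {f g : ℝ × ℝ → ℝ} {z : ℝ × ℝ} (hg : DifferentiableAt ℝ g z)
    (h : ∀ᶠ w in 𝓝 z, f w = w.1 * g w) :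
    fderiv ℝ f z (1, 0) = g z + z.1 * fderiv ℝ g z (1, 0) := by
  have h1 : HasFDerivAt (fun w : ℝ × ℝ => w.1 * g w) _ z := hasFDerivAt_fst.mul hg.hasFDerivAt
  rw [(h1.congr_of_eventuallyEq h).fderiv]
  simp [add_comm]

/-- A smooth germ with `f = ∂_s f = 0` on the line `s = 0` and `∂_s² f ≠ 0` at the origin is, up to
sign, the square of a germ vanishing on this line, with non-zero derivative in `s`. -/
theorem SmoothNear.exists_eq_mul_sq {f : ℝ × ℝ → ℝ} (hf : SmoothNear f 0)
    (h0 : ∀ᶠ t in 𝓝 (0 : ℝ), f (0, t) = 0)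
    (h1 : ∀ᶠ t in 𝓝 (0 : ℝ), fderiv ℝ f (0, t) (1, 0) = 0)
    (h2 : fderiv ℝ (fun z => fderiv ℝ f z (1, 0)) 0 (1, 0) ≠ 0) :
    ∃ (ε : ℝ) (B : ℝ × ℝ → ℝ), ε ≠ 0 ∧ SmoothNear B 0 ∧ B 0 = 0 ∧ fderiv ℝ B 0 (1, 0) ≠ 0 ∧
      ∀ᶠ z in 𝓝 (0 : ℝ × ℝ), f z = ε * B z ^ 2 := by
  obtain ⟨g, hg, hfg⟩ := hf.exists_eq_fst_mul h0
  have hDf : ∀ᶠ z in 𝓝 (0 : ℝ × ℝ), fderiv ℝ f z (1, 0) = g z + z.1 * fderiv ℝ g z (1, 0) := by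
    filter_upwards [hfg.eventually_nhds, hg.eventually_differentiableAt] with z hz hz'
    exact fderiv_eq_of_eq_fst_mul hz' hz
  have hg0 : ∀ᶠ t in 𝓝 (0 : ℝ), g (0, t) = 0 := by
    filter_upwards [h1, tendsto_zero_prodMk_nhds.eventually hDf] with t ht ht'
    rw [ht] at ht'
    simpa using ht'.symm
  obtain ⟨m, hm, hgm⟩ := hg.exists_eq_fst_mul hg0
  have hDg : ∀ᶠ z in 𝓝 (0 : ℝ × ℝ), fderiv ℝ g z (1, 0) = m z + z.1 * fderiv ℝ m z (1, 0) := by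
    filter_upwards [hgm.eventually_nhds, hm.eventually_differentiableAt] with z hz hz'
    exact fderiv_eq_of_eq_fst_mul hz' hz
  have hm0 : m 0 ≠ 0 := by
    intro hm0
    apply h2
    have h3 : ∀ᶠ z in 𝓝 (0 : ℝ × ℝ),
        fderiv ℝ f z (1, 0) = z.1 * (m z + fderiv ℝ g z (1, 0)) := by
      filter_upwards [hDf, hgm] with z h4 h5
      rw [h4, h5]
      ring
    rw [fderiv_eq_of_eq_fst_mul (hm.add (hg.fderiv_apply _)).differentiableAt h3,
      hDg.self_of_nhds, hm0]
    simp
  -- `f = s² m` with `m 0 ≠ 0`, and `ε` is the sign of `m 0`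
  set ε : ℝ := if 0 < m 0 then 1 else -1 with hε
  have hε2 : ε * ε = 1 := by
    rcases lt_or_gt_of_ne hm0 with h | h <;> simp [hε, h, h.not_gt]
  have hεm : 0 < ε * m 0 := by
    rcases lt_or_gt_of_ne hm0 with h | h <;> simp [hε, h, h.not_gt]
  have hsm : SmoothNear (fun z => ε * m z) 0 := (smoothNear_const ε _).mul hm
  have hpos : ∀ᶠ z in 𝓝 (0 : ℝ × ℝ), 0 < ε * m z :=
    hsm.continuousAt.eventually (lt_mem_nhds hεm)
  have hr : SmoothNear (fun z => √(ε * m z)) 0 := by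
    filter_upwards [hsm, hpos] with z h3 h4
    exact h3.sqrt h4.ne'
  refine ⟨ε, fun z => z.1 * √(ε * m z), ?_, (smoothNear_fst _).mul hr, by simp, ?_, ?_⟩
  · rintro h
    simp [h] at hε2
  · rw [fderiv_eq_of_eq_fst_mul hr.differentiableAt (Eventually.of_forall fun _ => rfl)]
    simpa using (Real.sqrt_pos.2 hεm).ne'
  · filter_upwards [hfg, hgm, hpos] with z h3 h4 h5
    rw [h3, h4, mul_pow, Real.sq_sqrt h5.le]
    linear_combination (-(z.1 ^ 2 * m z)) * hε2

/-- The Morse lemma with a parameter: a smooth germ `f(s, t)` with a non-degenerate critical point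
in `s` is of the form `m(t) + ε B(s, t)²`, with `∂_s B ≠ 0`. -/
theorem SmoothNear.exists_eq_add_mul_sq {f : ℝ × ℝ → ℝ} (hf : SmoothNear f 0)
    (h1 : fderiv ℝ f 0 (1, 0) = 0)
    (h2 : fderiv ℝ (fun z => fderiv ℝ f z (1, 0)) 0 (1, 0) ≠ 0) :
    ∃ (ε : ℝ) (m : ℝ → ℝ) (B : ℝ × ℝ → ℝ), ε ≠ 0 ∧ SmoothNear m 0 ∧ m 0 = f 0 ∧ SmoothNear B 0 ∧
      B 0 = 0 ∧ fderiv ℝ B 0 (1, 0) ≠ 0 ∧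
      ∀ᶠ z in 𝓝 (0 : ℝ × ℝ), f z = m z.2 + ε * B z ^ 2 := by
  -- the curve of critical points is `s = c t`
  obtain ⟨c, hc, hc0, hDc⟩ : ∃ c : ℝ → ℝ, SmoothNear c 0 ∧ c 0 = 0 ∧
      ∀ᶠ t in 𝓝 (0 : ℝ), fderiv ℝ f (c t, t) (1, 0) = 0 := by
    have hX : SmoothNear (fun z : ℝ × ℝ => (fderiv ℝ f z (1, 0), z.2)) 0 :=
      (hf.fderiv_apply _).prodMk (smoothNear_snd _)
    have hX' : HasFDerivAt (fun z : ℝ × ℝ => (fderiv ℝ f z (1, 0), z.2)) _ 0 :=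
      (hf.fderiv_apply (1, 0)).differentiableAt.hasFDerivAt.prodMk hasFDerivAt_snd
    obtain ⟨g, hg, hg0, hfg, -⟩ := hX.exists_local_inverse (by
      rw [hX'.fderiv, det_eq]
      simpa using h2)
    simp only [h1, Prod.snd_zero, Prod.mk_zero_zero] at hg hg0 hfg
    have hg' : SmoothNear g ((fun t : ℝ => ((0 : ℝ), t)) 0) := hg
    refine ⟨fun t => (g (0, t)).1, (smoothNear_fst _).comp
      (hg'.comp ((smoothNear_const _ _).prodMk (smoothNear_of_contDiff contDiff_id _))), ?_, ?_⟩
    · simp [hg0, Prod.mk_zero_zero]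
    · filter_upwards [tendsto_zero_prodMk_nhds.eventually hfg] with t ht
      rw [Prod.mk.injEq] at ht
      have h3 : ((g (0, t)).1, t) = g (0, t) := by ext <;> simp [ht.2]
      rw [h3]
      exact ht.1
  have hsh : SmoothNear (fun z : ℝ × ℝ => (z.1 + c z.2, z.2)) 0 :=
    ((smoothNear_fst _).add (hc.comp_of_eq (smoothNear_snd _) rfl)).prodMk (smoothNear_snd _)
  have hsh0 : (fun z : ℝ × ℝ => (z.1 + c z.2, z.2)) 0 = 0 := by simp [hc0]
  have hm : SmoothNear (fun t : ℝ => f (c t, t)) 0 :=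
    hf.comp_of_eq (hc.prodMk (smoothNear_of_contDiff contDiff_id _)) (by simp [hc0])
  -- in the coordinate `s - c t`, and up to its critical value, `f` is critical on the line `s = 0`
  let N : ℝ × ℝ → ℝ := fun z => f (z.1 + c z.2, z.2) - f (c z.2, z.2)
  have hN : SmoothNear N 0 :=
    (hf.comp_of_eq hsh hsh0).sub (hm.comp_of_eq (smoothNear_snd _) rfl)
  have hDN : ∀ᶠ z in 𝓝 (0 : ℝ × ℝ),
      fderiv ℝ N z (1, 0) = fderiv ℝ f (z.1 + c z.2, z.2) (1, 0) := by
    have ht : Tendsto (fun z : ℝ × ℝ => (z.1 + c z.2, z.2)) (𝓝 0) (𝓝 0) := by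
      have := hsh.continuousAt
      simpa [ContinuousAt, hc0, Prod.mk_zero_zero] using this
    filter_upwards [hN.eventually_differentiableAt, ht.eventually hf.eventually_differentiableAt]
      with z h3 h4
    have h5 := hasDerivAt_fst_of_differentiableAt h3
    have h6 := (HasDerivAt.comp_add_const z.1 (c z.2)
      (hasDerivAt_fst_of_differentiableAt h4)).sub_const (f (c z.2, z.2))
    exact h5.unique h6
  have hDNf : SmoothNear (fun z => fderiv ℝ f z (1, 0)) 0 := hf.fderiv_apply _
  obtain ⟨ε, B, hε, hB, hB0, hDB, hNB⟩ := hN.exists_eq_mul_sq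
    (Eventually.of_forall fun t => by simp [N])
    (by
      filter_upwards [tendsto_zero_prodMk_nhds.eventually hDN, hDc] with t h3 h4
      rw [h3]
      simpa using h4)
    (by
      have h3 : (fun z => fderiv ℝ N z (1, 0)) =ᶠ[𝓝 0]
        fun z => fderiv ℝ f (z.1 + c z.2, z.2) (1, 0) := hDN
      rw [h3.fderiv_eq]
      have h4 := hasDerivAt_fst_of_differentiableAt
        (hDNf.comp_of_eq hsh hsh0).differentiableAt
      have h5 := HasDerivAt.comp_add_const 0 (c 0)
        (hasDerivAt_fst_of_differentiableAt (f := fun z => fderiv ℝ f z (1, 0)) (z := (0 + c 0, 0))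
          (by simpa [hc0, Prod.mk_zero_zero] using hDNf.differentiableAt))
      have h6 : fderiv ℝ (fun z : ℝ × ℝ => fderiv ℝ f (z.1 + c z.2, z.2) (1, 0)) 0 (1, 0) =
        fderiv ℝ (fun z => fderiv ℝ f z (1, 0)) (0 + c 0, 0) (1, 0) := h4.unique h5
      rw [h6, hc0, add_zero]
      exact h2)
  refine ⟨ε, fun t => f (c t, t), fun z => B (z.1 - c z.2, z.2), hε, hm,
    by simp [hc0, Prod.mk_zero_zero], ?_, ?_, ?_, ?_⟩
  · exact hB.comp_of_eq (((smoothNear_fst _).sub (hc.comp_of_eq (smoothNear_snd _) rfl)).prodMk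
      (smoothNear_snd _)) (by simp [hc0])
  · simp [hc0, hB0, Prod.mk_zero_zero]
  · have hcs : SmoothNear (fun z : ℝ × ℝ => (z.1 - c z.2, z.2)) 0 :=
      ((smoothNear_fst _).sub (hc.comp_of_eq (smoothNear_snd _) rfl)).prodMk (smoothNear_snd _)
    have h3 := hasDerivAt_fst_of_differentiableAt
      (hB.comp_of_eq hcs (by simp [hc0])).differentiableAt
    have h4 := HasDerivAt.comp_sub_const 0 (c 0)
      (hasDerivAt_fst_of_differentiableAt (f := B) (z := (0 - c 0, 0))
        (by simpa [hc0, Prod.mk_zero_zero] using hB.differentiableAt))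
    have h5 : fderiv ℝ (fun z : ℝ × ℝ => B (z.1 - c z.2, z.2)) 0 (1, 0) =
      fderiv ℝ B (0 - c 0, 0) (1, 0) := h3.unique h4
    rw [h5, hc0, sub_zero]
    exact hDB
  · have ht : Tendsto (fun z : ℝ × ℝ => (z.1 - c z.2, z.2)) (𝓝 0) (𝓝 0) := by
      have : ContinuousAt (fun z : ℝ × ℝ => (z.1 - c z.2, z.2)) 0 :=
        (((smoothNear_fst _).sub (hc.comp_of_eq (smoothNear_snd _) rfl)).prodMk
          (smoothNear_snd _)).continuousAt
      simpa [ContinuousAt, hc0, Prod.mk_zero_zero] using this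
    filter_upwards [ht.eventually hNB] with z h3
    rw [← h3]
    simp [N]

/-! ### Whitney folds -/

/-- The infinitesimal criterion for a fold: `f` is smooth near `p`, the vector `k ≠ 0` spans the
kernel of the differential at `p`, and the derivative of the Jacobian determinant in the direction
`k` does not vanish. -/
structure FoldCriterion (f : ℝ × ℝ → ℝ × ℝ) (p k : ℝ × ℝ) : Prop where
  smooth : SmoothNear f p
  ne_zero : k ≠ 0
  apply_eq_zero : fderiv ℝ f p k = 0
  deriv_det_ne_zero : fderiv ℝ (fun z => (fderiv ℝ f z).det) p k ≠ 0

theorem det_comp (A B : ℝ × ℝ →L[ℝ] ℝ × ℝ) : (A.comp B).det = A.det * B.det :=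
  LinearMap.det_comp (A : ℝ × ℝ →ₗ[ℝ] ℝ × ℝ) (B : ℝ × ℝ →ₗ[ℝ] ℝ × ℝ)

theorem FoldCriterion.det_eq_zero {f : ℝ × ℝ → ℝ × ℝ} {p k : ℝ × ℝ} (h : FoldCriterion f p k) :
    (fderiv ℝ f p).det = 0 := by
  rw [← ker_ne_bot_iff]
  intro hb
  exact h.ne_zero (LinearMap.ker_eq_bot'.1 hb k h.apply_eq_zero)

/-- The Jacobian determinant is quadratic in the differential, so that its derivative would vanish
if the differential did. -/
theorem FoldCriterion.fderiv_ne_zero {f : ℝ × ℝ → ℝ × ℝ} {p k : ℝ × ℝ}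
    (h : FoldCriterion f p k) : fderiv ℝ f p ≠ 0 := by
  intro h0
  apply h.deriv_det_ne_zero
  have h1 := (h.smooth.fderiv_apply (1, 0)).differentiableAt.hasFDerivAt
  have h2 := (h.smooth.fderiv_apply (0, 1)).differentiableAt.hasFDerivAt
  have h3 := (h1.fst.mul h2.snd).sub (h2.fst.mul h1.snd)
  have h4 : (fun z => (fderiv ℝ f z).det) = fun z =>
      (fderiv ℝ f z (1, 0)).1 * (fderiv ℝ f z (0, 1)).2 -
      (fderiv ℝ f z (0, 1)).1 * (fderiv ℝ f z (1, 0)).2 := funext fun z => det_eq _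
  have h5 := h3.fderiv
  simp only [h0] at h5
  rw [h4]
  refine (DFunLike.congr_fun h5 k).trans ?_
  simp

theorem finrank_ker_eq_one {L : ℝ × ℝ →L[ℝ] ℝ × ℝ} (h0 : L ≠ 0)
    (hk : LinearMap.ker (L : ℝ × ℝ →ₗ[ℝ] ℝ × ℝ) ≠ ⊥) :
    Module.finrank ℝ (LinearMap.ker (L : ℝ × ℝ →ₗ[ℝ] ℝ × ℝ)) = 1 := by
  have h1 : Module.finrank ℝ (LinearMap.ker (L : ℝ × ℝ →ₗ[ℝ] ℝ × ℝ)) ≠ 0 := fun h =>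
    hk (Submodule.finrank_eq_zero.1 h)
  have h2 : Module.finrank ℝ (LinearMap.ker (L : ℝ × ℝ →ₗ[ℝ] ℝ × ℝ)) <
      Module.finrank ℝ (ℝ × ℝ) := by
    refine Submodule.finrank_lt ?_
    intro h
    apply h0
    refine ContinuousLinearMap.ext fun x => ?_
    have : x ∈ LinearMap.ker (L : ℝ × ℝ →ₗ[ℝ] ℝ × ℝ) := by rw [h]; trivial
    exact this
  have h3 : Module.finrank ℝ (ℝ × ℝ) = 2 := by simp
  omega

/-- A curve of singularities has a velocity in the kernel of the derivative of the determinant,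
which does not contain `k`. -/
theorem FoldCriterion.isFoldSingularity {f : ℝ × ℝ → ℝ × ℝ} {p k : ℝ × ℝ}
    (h : FoldCriterion f p k) : SubRiem.IsFoldSingularity f p := by
  have hδ := h.smooth.det_fderiv
  have h1 : ∀ᶠ z in 𝓝 p, fderiv ℝ f z ≠ 0 :=
    h.smooth.smoothNear_fderiv.continuousAt.eventually_ne h.fderiv_ne_zero
  have h2 : ∀ᶠ z in 𝓝 p, fderiv ℝ (fun z => (fderiv ℝ f z).det) z k ≠ 0 :=
    (hδ.fderiv_apply k).continuousAt.eventually_ne h.deriv_det_ne_zero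
  obtain ⟨U, hU, hpU, hfU, hUP⟩ := h.smooth.exists_isOpen (h1.and h2)
  have hps : p ∈ SubRiem.singularSet f := mem_singularSet_iff.2 h.det_eq_zero
  have hrank : ∀ x ∈ SubRiem.singularSet f ∩ U,
      Module.finrank ℝ (LinearMap.ker (fderiv ℝ f x : ℝ × ℝ →ₗ[ℝ] ℝ × ℝ)) = 1 :=
    fun x hx => finrank_ker_eq_one (hUP x hx.2).1 hx.1
  refine ⟨U, ⟨hU, hpU, hps, hfU, fun x hx _ => ?_, hrank⟩, ?_⟩
  · intro y
    refine ⟨(y / fderiv ℝ (fun z => (fderiv ℝ f z).det) x k) • k, ?_⟩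
    rw [map_smul, smul_eq_mul, div_mul_cancel₀ _ (hUP x hx).2]
  · ext w
    simp only [mem_inter_iff, SetLike.mem_coe, mem_singleton_iff]
    constructor
    · rintro ⟨⟨c, ε, hε, -, hcS, hc0, hcw⟩, hw⟩
      have hk : k ∈ LinearMap.ker (fderiv ℝ f p : ℝ × ℝ →ₗ[ℝ] ℝ × ℝ) := h.apply_eq_zero
      obtain ⟨a, ha⟩ := (finrank_eq_one_iff_of_nonzero' (⟨k, hk⟩ :
        LinearMap.ker (fderiv ℝ f p : ℝ × ℝ →ₗ[ℝ] ℝ × ℝ))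
        (fun h0 => h.ne_zero (congrArg Subtype.val h0))).1 (hrank p ⟨hps, hpU⟩) ⟨w, hw⟩
      have ha' : a • k = w := congrArg Subtype.val ha
      have hd1 : HasDerivAt (fun t => (fderiv ℝ f (c t)).det)
          (fderiv ℝ (fun z => (fderiv ℝ f z).det) p w) 0 := by
        have h3 := hδ.differentiableAt.hasFDerivAt
        rw [← hc0] at h3
        have h4 := h3.comp_hasDerivAt 0 hcw
        rwa [hc0] at h4
      have hd2 : HasDerivAt (fun t => (fderiv ℝ f (c t)).det) 0 0 := by
        refine (hasDerivAt_const (0 : ℝ) (0 : ℝ)).congr_of_eventuallyEq ?_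
        filter_upwards [Ioo_mem_nhds (neg_lt_zero.2 hε) hε] with t ht
        exact mem_singularSet_iff.1 (hcS t ht).1
      have h5 := hd1.unique hd2
      rw [← ha', map_smul, smul_eq_mul] at h5
      rcases mul_eq_zero.1 h5 with h6 | h6
      · rw [← ha', h6, zero_smul]
      · exact absurd h6 h.deriv_det_ne_zero
    · rintro rfl
      exact ⟨⟨fun _ => p, 1, one_pos, contDiffOn_const, fun _ _ => ⟨hps, hpU⟩, rfl,
        hasDerivAt_const _ _⟩, Submodule.zero_mem _⟩

/-- Equivalence of map germs, from coordinate changes given as germs. -/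
theorem isEquivalentNear_of_smoothNear {f g φ ψ : ℝ × ℝ → ℝ × ℝ} {p : ℝ × ℝ}
    (hf : ContinuousAt f p) (hφ : SmoothNear φ p) (hφ0 : φ p = 0) (hφd : (fderiv ℝ φ p).det ≠ 0)
    (hψ : SmoothNear ψ (f p)) (hψ0 : ψ (f p) = 0) (hψd : (fderiv ℝ ψ (f p)).det ≠ 0)
    (h : ∀ᶠ z in 𝓝 p, ψ (f z) = g (φ z)) : SubRiem.IsEquivalentNear f p g := by
  obtain ⟨Ψ, hΨp, hΨ, -, hΨ1, hΨ2⟩ :=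
    hψ.exists_openPartialHomeomorph hψd (P := fun _ => True) (by simp)
  obtain ⟨Φ, hΦp, hΦ, hΦP, hΦ1, hΦ2⟩ := hφ.exists_openPartialHomeomorph hφd
    (h.and (hf.eventually (Ψ.open_source.mem_nhds hΨp)))
  refine ⟨Φ, Ψ, ⟨hΦp, by rw [hΦ, hφ0], hΦ1, hΦ2⟩, ⟨hΨp, by rw [hΨ, hψ0], hΨ1, hΨ2⟩,
    fun z hz => (hΦP z hz).2, fun z hz => ?_⟩
  rw [hΨ, hΦ]
  exact (hΦP z hz).1

/-- Whitney's normal form of a fold. In coordinates `(s, t)` of the source where one component of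
`f` is `t`, the other one has a non-degenerate critical point in `s`, and the Morse lemma with the
parameter `t` applies. -/
theorem FoldCriterion.isEquivalentNear {f : ℝ × ℝ → ℝ × ℝ} {p k : ℝ × ℝ}
    (h : FoldCriterion f p k) : SubRiem.IsEquivalentNear f p (fun z => (z.1 ^ 2, z.2)) := by
  -- `w` spans the range of the differential
  obtain ⟨e, he⟩ : ∃ e, fderiv ℝ f p e ≠ 0 := by
    by_contra! hc
    exact h.fderiv_ne_zero (ContinuousLinearMap.ext hc)
  set L := fderiv ℝ f p with hL
  set w := L e with hw
  have hww : 0 < w.1 * w.1 + w.2 * w.2 := by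
    by_contra! hc
    apply he
    ext
    · simp only [Prod.fst_zero]; nlinarith
    · simp only [Prod.snd_zero]; nlinarith
  have hkk : 0 < k.1 * k.1 + k.2 * k.2 := by
    by_contra! hc
    apply h.ne_zero
    ext
    · simp only [Prod.fst_zero]; nlinarith
    · simp only [Prod.snd_zero]; nlinarith
  have hLk : L k = 0 := h.apply_eq_zero
  have hdet : L.det = 0 := h.det_eq_zero
  -- linear coordinates of the target, and the components of `f` in them
  let ℓ₁ : ℝ × ℝ →L[ℝ] ℝ :=
    w.1 • ContinuousLinearMap.snd ℝ ℝ ℝ - w.2 • ContinuousLinearMap.fst ℝ ℝ ℝ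
  let ℓ₂ : ℝ × ℝ →L[ℝ] ℝ :=
    w.1 • ContinuousLinearMap.fst ℝ ℝ ℝ + w.2 • ContinuousLinearMap.snd ℝ ℝ ℝ
  let σ : ℝ × ℝ →L[ℝ] ℝ := k.1 • ContinuousLinearMap.fst ℝ ℝ ℝ + k.2 • ContinuousLinearMap.snd ℝ ℝ ℝ
  have hℓ₁ : ∀ y, ℓ₁ y = w.1 * y.2 - w.2 * y.1 := fun y => by simp [ℓ₁]
  have hℓ₂ : ∀ y, ℓ₂ y = w.1 * y.1 + w.2 * y.2 := fun y => by simp [ℓ₂]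
  have hσ : ∀ y, σ y = k.1 * y.1 + k.2 * y.2 := fun y => by simp [σ]
  have hsub : SmoothNear (fun z => f z - f p) p := h.smooth.sub (smoothNear_const _ _)
  have hf₁ : SmoothNear (fun z => ℓ₁ (f z - f p)) p :=
    (smoothNear_of_contDiff ℓ₁.contDiff _).comp hsub
  have hf₂ : SmoothNear (fun z => ℓ₂ (f z - f p)) p :=
    (smoothNear_of_contDiff ℓ₂.contDiff _).comp hsub
  have hD₁ : ∀ z, DifferentiableAt ℝ f z →
      HasFDerivAt (fun z => ℓ₁ (f z - f p)) (ℓ₁.comp (fderiv ℝ f z)) z := fun z hz =>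
    ℓ₁.hasFDerivAt.comp z (hz.hasFDerivAt.sub_const (f p))
  have hD₂ : ∀ z, DifferentiableAt ℝ f z →
      HasFDerivAt (fun z => ℓ₂ (f z - f p)) (ℓ₂.comp (fderiv ℝ f z)) z := fun z hz =>
    ℓ₂.hasFDerivAt.comp z (hz.hasFDerivAt.sub_const (f p))
  have hDσ : ∀ z, HasFDerivAt (fun z => σ (z - p)) σ z := fun z =>
    σ.hasFDerivAt.comp z ((hasFDerivAt_id z).sub_const p)
  -- source coordinates `θ = (s, t)` in which the second component of `f` is `t`
  let θ : ℝ × ℝ → ℝ × ℝ := fun z => (σ (z - p), ℓ₂ (f z - f p))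
  have hθ : SmoothNear θ p := SmoothNear.prodMk
    (smoothNear_of_contDiff (σ.contDiff.comp (contDiff_id.sub contDiff_const)) p) hf₂
  have hθ0 : θ p = 0 := by simp [θ]
  have hDθ : ∀ z, DifferentiableAt ℝ f z → HasFDerivAt θ (σ.prod (ℓ₂.comp (fderiv ℝ f z))) z :=
    fun z hz => (hDσ z).prodMk (hD₂ z hz)
  have hDθp := hDθ p h.smooth.differentiableAt
  have hLx : ∀ x, L x = x.1 • L (1, 0) + x.2 • L (0, 1) := apply_eq L
  have hθd : (fderiv ℝ θ p).det ≠ 0 := by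
    rw [hDθp.fderiv, det_eq]
    simp only [ContinuousLinearMap.prod_apply, ContinuousLinearMap.comp_apply, hσ, mul_one,
      mul_zero, add_zero, zero_add]
    intro h0
    have h1 : ℓ₂ (L k) = 0 := by rw [hLk, map_zero]
    rw [hLx, map_add, map_smul, map_smul, smul_eq_mul, smul_eq_mul] at h1
    have h2 : ℓ₂ (L e) = w.1 * w.1 + w.2 * w.2 := by rw [hℓ₂]
    rw [hLx, map_add, map_smul, map_smul, smul_eq_mul, smul_eq_mul] at h2
    have h3 : (k.1 * k.1 + k.2 * k.2) * ℓ₂ (L (1, 0)) = 0 := by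
      linear_combination k.1 * h1 - k.2 * h0
    have h4 : (k.1 * k.1 + k.2 * k.2) * ℓ₂ (L (0, 1)) = 0 := by
      linear_combination k.2 * h1 + k.1 * h0
    have h5 := (mul_eq_zero.1 h3).resolve_left hkk.ne'
    have h6 := (mul_eq_zero.1 h4).resolve_left hkk.ne'
    rw [h5, h6] at h2
    linarith
  obtain ⟨g, hg, hg0, hθg, hgθ⟩ := hθ.exists_local_inverse hθd
  rw [hθ0] at hg hg0 hθg
  -- the first component of `f` in these coordinates
  let K : ℝ × ℝ → ℝ := fun x => ℓ₁ (f (g x) - f p)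
  have hK : SmoothNear K 0 := hf₁.comp_of_eq hg hg0
  have hKθ : ∀ᶠ z in 𝓝 p, ℓ₁ (f z - f p) = K (θ z) := by
    filter_upwards [hgθ] with z hz
    simp only [K, hz]
  have hθc : Tendsto θ (𝓝 p) (𝓝 0) := by
    have := hθ.continuousAt.tendsto
    rwa [hθ0] at this
  -- the Jacobian determinant of `f` is that of `θ` times `∂_s K`, up to a constant
  have hjac : ∀ᶠ z in 𝓝 p, (w.1 * w.1 + w.2 * w.2) * (fderiv ℝ f z).det =
      -((fderiv ℝ θ z).det * fderiv ℝ K (θ z) (1, 0)) := by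
    filter_upwards [hKθ.eventually_nhds, h.smooth.eventually_differentiableAt,
      hθc.eventually hK.eventually_differentiableAt, hθ.eventually_differentiableAt]
      with z h1 h2 h3 h4
    have h5 : HasFDerivAt (fun z => ℓ₁ (f z - f p)) ((fderiv ℝ K (θ z)).comp (fderiv ℝ θ z)) z :=
      (h3.hasFDerivAt.comp z h4.hasFDerivAt).congr_of_eventuallyEq h1
    have h6 := (hD₁ z h2).unique h5
    rw [(hDθ z h2).fderiv] at h6 ⊢
    have h7 := DFunLike.congr_fun h6 (1, 0)
    have h8 := DFunLike.congr_fun h6 (0, 1)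
    simp only [ContinuousLinearMap.comp_apply, ContinuousLinearMap.prod_apply] at h7 h8
    rw [apply_eq (fderiv ℝ K (θ z))] at h7 h8
    rw [det_eq, det_eq]
    simp only [ContinuousLinearMap.comp_apply, ContinuousLinearMap.prod_apply, smul_eq_mul, hσ,
      hℓ₁, hℓ₂, mul_one, mul_zero, add_zero, zero_add] at h7 h8 ⊢
    linear_combination (w.1 * (fderiv ℝ f z (1, 0)).1 + w.2 * (fderiv ℝ f z (1, 0)).2) * h8 -
      (w.1 * (fderiv ℝ f z (0, 1)).1 + w.2 * (fderiv ℝ f z (0, 1)).2) * h7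
  have hK1 : fderiv ℝ K 0 (1, 0) = 0 := by
    have h1 := hjac.self_of_nhds
    rw [h.det_eq_zero, mul_zero, hθ0] at h1
    exact (mul_eq_zero.1 (neg_eq_zero.1 h1.symm)).resolve_left hθd
  have hK2 : fderiv ℝ (fun z => fderiv ℝ K z (1, 0)) 0 (1, 0) ≠ 0 := by
    intro h0
    have h1 : HasFDerivAt (fun z => (w.1 * w.1 + w.2 * w.2) * (fderiv ℝ f z).det)
        ((w.1 * w.1 + w.2 * w.2) • fderiv ℝ (fun z => (fderiv ℝ f z).det) p) p :=
      h.smooth.det_fderiv.differentiableAt.hasFDerivAt.const_mul _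
    have h2 : HasFDerivAt (fun z => fderiv ℝ K z (1, 0))
        (fderiv ℝ (fun z => fderiv ℝ K z (1, 0)) 0) (θ p) := by
      rw [hθ0]
      exact (hK.fderiv_apply (1, 0)).differentiableAt.hasFDerivAt
    have h3 := (hθ.det_fderiv.differentiableAt.hasFDerivAt.mul (h2.comp p hDθp)).neg
    have h4 := DFunLike.congr_fun ((h1.congr_of_eventuallyEq (f₁ := fun z =>
      -((fderiv ℝ θ z).det * fderiv ℝ K (θ z) (1, 0)))
      (hjac.mono fun _ hz => hz.symm)).unique h3) k
    have h5 : (σ.prod (ℓ₂.comp L)) k = (k.1 * k.1 + k.2 * k.2) • (1, 0) := by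
      simp [hσ, hLk]
    have h6 : ((fun z => fderiv ℝ K z (1, 0)) ∘ θ) p = 0 := by
      simp only [Function.comp_apply, hθ0, hK1]
    simp only [FunLike.coe_smul, Pi.smul_apply, neg_apply,
      add_apply, ContinuousLinearMap.comp_apply, h6, zero_smul,
      smul_eq_mul] at h4
    rw [h5, map_smul, h0] at h4
    have h8 : (w.1 * w.1 + w.2 * w.2) * fderiv ℝ (fun z => (fderiv ℝ f z).det) p k = 0 := by
      refine h4.trans ?_
      simp
    rcases mul_eq_zero.1 h8 with h7 | h7
    · exact hww.ne' h7
    · exact h.deriv_det_ne_zero h7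
  obtain ⟨ε, m, B, hε, hm, hm0, hB, hB0, hBd, hKB⟩ := hK.exists_eq_add_mul_sq hK1 hK2
  have hK0 : K 0 = 0 := by simp [K, hg0]
  rw [hK0] at hm0
  have hDm : HasDerivAt m (deriv m 0) 0 := hm.differentiableAt.hasDerivAt
  -- the square is made exact by subtracting the fold value `m` in the target
  refine isEquivalentNear_of_smoothNear (φ := fun z => (B (θ z), (θ z).2))
    (ψ := fun y => ((ℓ₁ (y - f p) - m (ℓ₂ (y - f p))) / ε, ℓ₂ (y - f p)))
    h.smooth.continuousAt ?_ ?_ ?_ ?_ ?_ ?_ ?_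
  · exact (hB.comp_of_eq hθ hθ0).prodMk ((smoothNear_snd _).comp hθ)
  · simp [hθ0, hB0]
  · have h1 : HasFDerivAt B (fderiv ℝ B 0) (θ p) := by
      rw [hθ0]
      exact hB.differentiableAt.hasFDerivAt
    have h2 := (h1.prodMk hasFDerivAt_snd).comp p hθ.differentiableAt.hasFDerivAt
    have h3 : fderiv ℝ (fun z => (B (θ z), (θ z).2)) p =
      ((fderiv ℝ B 0).prod (ContinuousLinearMap.snd ℝ ℝ ℝ)).comp (fderiv ℝ θ p) := h2.fderiv
    rw [h3, det_comp, det_eq]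
    simpa using ⟨hBd, hθd⟩
  · have h1 : SmoothNear (fun y => y - f p) (f p) :=
      smoothNear_of_contDiff (contDiff_id.sub contDiff_const) _
    have h2 := (smoothNear_of_contDiff ℓ₁.contDiff _).comp h1
    have h3 := (smoothNear_of_contDiff ℓ₂.contDiff _).comp h1
    simp only [div_eq_mul_inv]
    exact ((h2.sub (hm.comp_of_eq h3 (by simp))).mul (smoothNear_const _ _)).prodMk h3
  · simp [hm0]
  · have h1 : HasFDerivAt (fun y => ℓ₁ (y - f p)) ℓ₁ (f p) :=
      ℓ₁.hasFDerivAt.comp (f p) ((hasFDerivAt_id (f p)).sub_const (f p))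
    have h2 : HasFDerivAt (fun y => ℓ₂ (y - f p)) ℓ₂ (f p) :=
      ℓ₂.hasFDerivAt.comp (f p) ((hasFDerivAt_id (f p)).sub_const (f p))
    have h3 : HasDerivAt m (deriv m 0) ((fun y => ℓ₂ (y - f p)) (f p)) := by simpa using hDm
    have h4 := ((h1.sub (h3.comp_hasFDerivAt (f p) h2)).mul_const ε⁻¹).prodMk h2
    have h5 : fderiv ℝ (fun y => ((ℓ₁ (y - f p) - m (ℓ₂ (y - f p))) / ε, ℓ₂ (y - f p))) (f p) = _ :=
      h4.fderiv
    rw [h5, det_eq]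
    simp only [ContinuousLinearMap.prod_apply, FunLike.coe_smul, Pi.smul_apply, hℓ₁, hℓ₂,
      sub_apply, smul_eq_mul, mul_one, mul_zero, add_zero, zero_add, zero_sub,
      sub_zero]
    intro h6
    apply hww.ne'
    field_simp at h6
    linear_combination -h6
  · filter_upwards [hKθ, hθc.eventually hKB] with z h1 h2
    rw [h1, h2]
    ext
    · simp only [θ, add_sub_cancel_left]
      field_simp
    · rfl

/-! ### Autonomous equations: global existence and uniqueness -/

/-- A continuously differentiable vector field with compact support is complete. -/
theorem exists_solution_of_hasCompactSupport {E : Type*} [NormedAddCommGroup E] [NormedSpace ℝ E]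
    [CompleteSpace E] {W : E → E} (hW : ContDiff ℝ 1 W) (hs : HasCompactSupport W) (z₀ : E) :
    ∃ γ : ℝ → E, γ 0 = z₀ ∧ ∀ t, HasDerivAt γ (W (γ t)) t := by
  obtain ⟨K, hK⟩ := hW.lipschitzWith_of_hasCompactSupport hs (by simp)
  obtain ⟨L, hL⟩ := hs.exists_bound_of_continuous hW.continuous
  have hL0 : 0 ≤ L := (norm_nonneg _).trans (hL z₀)
  have hloc : ∀ T : ℝ, 0 < T → ∃ γ : ℝ → E, γ 0 = z₀ ∧
      ∀ t ∈ Ioo (-T) T, HasDerivAt γ (W (γ t)) t := by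
    intro T hT
    have h0 : (0 : ℝ) ∈ Icc (-T) T := ⟨by linarith, hT.le⟩
    have hpl : IsPicardLindelof (fun _ => W) (⟨0, h0⟩ : Icc (-T) T) z₀ (⟨L, hL0⟩ * ⟨T, hT.le⟩) 0
        ⟨L, hL0⟩ K := by
      refine IsPicardLindelof.of_time_independent (fun x _ => hL x) hK.lipschitzOnWith ?_
      change L * max (T - 0) (0 - -T) ≤ L * T - 0
      simp
    obtain ⟨γ, h1, h2⟩ := hpl.exists_eq_forall_mem_Icc_hasDerivWithinAt₀
    exact ⟨γ, h1, fun t ht => (h2 t (Ioo_subset_Icc_self ht)).hasDerivAt (Icc_mem_nhds ht.1 ht.2)⟩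
  choose! γ hγ0 hγ using hloc
  have heq : ∀ T T' : ℝ, 0 < T → T ≤ T' → EqOn (γ T) (γ T') (Ioo (-T) T) := by
    intro T T' hT hTT
    refine ODE_solution_unique_of_mem_Ioo (v := fun _ => W) (s := fun _ => univ) (t₀ := 0)
      (fun t _ => hK.lipschitzOnWith) ⟨by linarith, hT⟩ (fun t ht => ⟨hγ T hT t ht, trivial⟩)
      (fun t ht => ⟨hγ T' (hT.trans_le hTT) t ⟨?_, ?_⟩, trivial⟩) ?_
    · linarith [ht.1]
    · linarith [ht.2]
    · rw [hγ0 T hT, hγ0 T' (hT.trans_le hTT)]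
  refine ⟨fun t => γ (|t| + 1) t, hγ0 _ (by positivity), fun t => ?_⟩
  have ht : t ∈ Ioo (-(|t| + 1)) (|t| + 1) :=
    ⟨by linarith [neg_abs_le t], by linarith [le_abs_self t]⟩
  refine (hγ (|t| + 1) (by positivity) t ht).congr_of_eventuallyEq ?_
  filter_upwards [isOpen_Ioo.mem_nhds ht] with s hs
  have hs' : s ∈ Ioo (-(|s| + 1)) (|s| + 1) :=
    ⟨by linarith [neg_abs_le s], by linarith [le_abs_self s]⟩
  rcases le_total (|s| + 1) (|t| + 1) with h | h
  · exact heq _ _ (by positivity) h hs'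
  · exact (heq _ _ (by positivity) h hs).symm

/-- A continuously differentiable vector field with a first integral whose level through `z₀` is
bounded has a global integral curve through `z₀`: cutting it off outside of a ball changes neither
the first integral nor the field on the level. -/
theorem exists_solution_of_first_integral {E : Type*} [NormedAddCommGroup E] [NormedSpace ℝ E]
    [FiniteDimensional ℝ E] {V : E → E} (hV : ContDiff ℝ 1 V) {H : E → ℝ}
    (hH : Differentiable ℝ H) (hHV : ∀ z, fderiv ℝ H z (V z) = 0) {z₀ : E} {R : ℝ}
    (hR : ∀ z, H z = H z₀ → ‖z‖ ≤ R) :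
    ∃ γ : ℝ → E, γ 0 = z₀ ∧ ∀ t, HasDerivAt γ (V (γ t)) t := by
  have hR0 : 0 ≤ R := (norm_nonneg _).trans (hR z₀ rfl)
  have : CompleteSpace E := FiniteDimensional.complete ℝ E
  let χ : ContDiffBump (0 : E) := ⟨R + 1, R + 2, by linarith, by linarith⟩
  obtain ⟨γ, h0, hγ⟩ := exists_solution_of_hasCompactSupport (W := fun z => χ z • V z)
    (χ.contDiff.smul hV) χ.hasCompactSupport.smul_right z₀
  have hconst : ∀ t, H (γ t) = H z₀ := by
    have hd : ∀ t, HasDerivAt (fun t => H (γ t)) 0 t := by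
      intro t
      have h1 := (hH (γ t)).hasFDerivAt.comp_hasDerivAt t (hγ t)
      rwa [map_smul, hHV, smul_zero] at h1
    intro t
    rw [← h0]
    exact is_const_of_deriv_eq_zero (fun t => (hd t).differentiableAt) (fun t => (hd t).deriv) t 0
  refine ⟨γ, h0, fun t => ?_⟩
  have h1 : χ (γ t) = 1 := by
    refine χ.one_of_mem_closedBall ?_
    rw [mem_closedBall_zero_iff]
    exact (hR _ (hconst t)).trans (by change R ≤ R + 1; linarith)
  have h2 := hγ t
  rwa [h1, one_smul] at h2

/-- Uniqueness: both solutions are bounded, and the field is Lipschitz on balls. -/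
theorem eqOn_of_solution {E : Type*} [NormedAddCommGroup E] [NormedSpace ℝ E]
    [FiniteDimensional ℝ E] {V : E → E} (hV : ContDiff ℝ 1 V) {T : ℝ} {γ δ : ℝ → E}
    (hγ : ∀ t ∈ Icc 0 T, HasDerivWithinAt γ (V (γ t)) (Icc 0 T) t)
    (hδ : ∀ t ∈ Icc 0 T, HasDerivWithinAt δ (V (δ t)) (Icc 0 T) t) (h0 : γ 0 = δ 0) :
    EqOn γ δ (Icc 0 T) := by
  have : ProperSpace E := FiniteDimensional.proper ℝ E
  have hγc : ContinuousOn γ (Icc 0 T) := fun t ht => (hγ t ht).continuousWithinAt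
  have hδc : ContinuousOn δ (Icc 0 T) := fun t ht => (hδ t ht).continuousWithinAt
  obtain ⟨A, hA⟩ := isCompact_Icc.exists_bound_of_continuousOn hγc
  obtain ⟨B, hB⟩ := isCompact_Icc.exists_bound_of_continuousOn hδc
  obtain ⟨K, hK⟩ := (hV.contDiffOn (s := closedBall 0 (max A B))).exists_lipschitzOnWith
    (by simp) (convex_closedBall _ _) (isCompact_closedBall _ _)
  have hright : ∀ t ∈ Ico 0 T, Icc 0 T ∈ 𝓝[≥] t := fun t ht =>
    mem_of_superset (Icc_mem_nhdsGE ht.2) (Icc_subset_Icc_left ht.1)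
  refine ODE_solution_unique_of_mem_Icc_right (v := fun _ => V)
    (s := fun _ => closedBall 0 (max A B)) (fun _ _ => hK) hγc
    (fun t ht => (hγ t (Ico_subset_Icc_self ht)).mono_of_mem_nhdsWithin (hright t ht))
    (fun t ht => ?_) hδc
    (fun t ht => (hδ t (Ico_subset_Icc_self ht)).mono_of_mem_nhdsWithin (hright t ht))
    (fun t ht => ?_) h0
  · rw [mem_closedBall_zero_iff]
    exact (hA t (Ico_subset_Icc_self ht)).trans (le_max_left _ _)
  · rw [mem_closedBall_zero_iff]
    exact (hB t (Ico_subset_Icc_self ht)).trans (le_max_right _ _)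

/-! ### The force of the potential `|x| ^ (2 * α)` -/

/-- The function `|x| ^ (2 * α - 2) * x`; the derivative of `|x| ^ (2 * α)` is `2 * α` times it. -/
noncomputable def force (α x : ℝ) : ℝ := |x| ^ (2 * α - 2) * x

section force

variable {α : ℝ}

theorem mul_force (hα : 1 ≤ α) (x : ℝ) : x * force α x = |x| ^ (2 * α) := by
  rcases eq_or_ne x 0 with rfl | hx
  · rw [abs_zero, Real.zero_rpow (by linarith), zero_mul]
  · have hx' : 0 < |x| := abs_pos.2 hx
    have : |x| ^ (2 * α) = |x| ^ (2 * α - 2) * |x| ^ (2 : ℕ) := by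
      rw [← Real.rpow_natCast, ← Real.rpow_add hx']
      norm_num
    rw [this, sq_abs, force]
    ring

theorem force_zero : force α 0 = 0 := mul_zero _

theorem force_neg (x : ℝ) : force α (-x) = -force α x := by simp [force]

theorem force_ne_zero {x : ℝ} (hx : x ≠ 0) : force α x ≠ 0 :=
  mul_ne_zero (Real.rpow_pos_of_pos (abs_pos.2 hx) _).ne' hx

theorem force_pos {x : ℝ} (hx : 0 < x) : 0 < force α x :=
  mul_pos (Real.rpow_pos_of_pos (abs_pos.2 hx.ne') _) hx

theorem force_mul {a : ℝ} (ha : 0 < a) (x : ℝ) :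
    force α (a * x) = a ^ (2 * α - 1) * force α x := by
  have : a ^ (2 * α - 1) = a ^ (2 * α - 2) * a := by
    rw [← Real.rpow_add_one ha.ne']
    congr 1
    ring
  rw [force, force, abs_mul, abs_of_pos ha, Real.mul_rpow ha.le (abs_nonneg x), this]
  ring

theorem hasDerivAt_abs_rpow_two_mul (hα : 1 ≤ α) (x : ℝ) :
    HasDerivAt (fun x => |x| ^ (2 * α)) (2 * α * force α x) x := by
  have h := hasDerivAt_abs_rpow x (p := 2 * α) (by linarith)
  rwa [mul_assoc] at h

theorem continuous_abs_rpow (hα : 1 ≤ α) : Continuous fun x : ℝ => |x| ^ (2 * α - 2) :=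
  continuous_abs.rpow_const fun _ => Or.inr (by linarith)

theorem contDiffAt_abs_rpow {x : ℝ} (hx : x ≠ 0) (β : ℝ) :
    ContDiffAt ℝ ∞ (fun x : ℝ => |x| ^ β) x :=
  (contDiffAt_abs hx).rpow_const_of_ne (abs_pos.2 hx).ne'

theorem contDiffAt_force {x : ℝ} (hx : x ≠ 0) : ContDiffAt ℝ ∞ (force α) x :=
  (contDiffAt_abs_rpow hx _).mul contDiffAt_id

theorem hasDerivAt_force (hα : 1 ≤ α) (x : ℝ) :
    HasDerivAt (force α) ((2 * α - 1) * |x| ^ (2 * α - 2)) x := by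
  rcases eq_or_ne x 0 with rfl | hx
  · -- at the origin the slope is `|x| ^ (2 * α - 2)`, whose limit is `1` or `0`
    have h1 : (2 * α - 1) * |(0 : ℝ)| ^ (2 * α - 2) = |(0 : ℝ)| ^ (2 * α - 2) := by
      rcases hα.eq_or_lt with rfl | h
      · norm_num
      · rw [abs_zero, Real.zero_rpow (by linarith), mul_zero]
    rw [h1, hasDerivAt_iff_tendsto_slope]
    refine (((continuous_abs_rpow hα).tendsto 0).mono_left nhdsWithin_le_nhds).congr' ?_
    filter_upwards [self_mem_nhdsWithin] with y hy
    rw [slope_def_field, force_zero, force, sub_zero, sub_zero, mul_div_cancel_right₀ _ hy]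
  · have h1 := (hasDerivAt_abs hx).rpow_const (p := 2 * α - 2) (Or.inl (abs_pos.2 hx).ne')
    have h2 := h1.mul (hasDerivAt_id x)
    refine h2.congr_deriv ?_
    have h3 : |x| ^ (2 * α - 2) = |x| ^ (2 * α - 2 - 1) * |x| := by
      rw [← Real.rpow_add_one (abs_pos.2 hx).ne']
      congr 1
      ring
    have h4 : (SignType.sign x : ℝ) * x = |x| := sign_mul_self x
    simp only [id]
    rw [h3]
    linear_combination ((2 * α - 2) * |x| ^ (2 * α - 2 - 1)) * h4

theorem contDiff_force (hα : 1 ≤ α) : ContDiff ℝ 1 (force α) := by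
  rw [contDiff_one_iff_deriv]
  refine ⟨fun x => (hasDerivAt_force hα x).differentiableAt, ?_⟩
  have : deriv (force α) = fun x => (2 * α - 1) * |x| ^ (2 * α - 2) :=
    funext fun x => (hasDerivAt_force hα x).deriv
  rw [this]
  exact continuous_const.mul (continuous_abs_rpow hα)

theorem continuous_force (hα : 1 ≤ α) : Continuous (force α) := (contDiff_force hα).continuous

theorem contDiff_abs_rpow_two_mul (hα : 1 ≤ α) : ContDiff ℝ 1 fun x : ℝ => |x| ^ (2 * α) := by
  simp only [← mul_force hα]
  exact contDiff_id.mul (contDiff_force hα)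

end force

/-! ### Normal extremals of the Grushin plane -/

/-- `(X, U, Y)` is, for all times, a solution of the Hamilton equations of the `α`-Grushin plane
with the constant momentum `v` in the direction `y`. -/
structure IsSolution (α v : ℝ) (X U Y : ℝ → ℝ) : Prop where
  hasDerivAt_X : ∀ t, HasDerivAt X (U t) t
  hasDerivAt_U : ∀ t, HasDerivAt U (-(α * v ^ 2 * force α (X t))) t
  hasDerivAt_Y : ∀ t, HasDerivAt Y (v * |X t| ^ (2 * α)) t

section IsSolution

variable {α v : ℝ} {X U Y : ℝ → ℝ}

theorem IsSolution.continuous_X (h : IsSolution α v X U Y) : Continuous X :=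
  continuous_iff_continuousAt.2 fun t => (h.hasDerivAt_X t).continuousAt

theorem IsSolution.continuous_U (h : IsSolution α v X U Y) : Continuous U :=
  continuous_iff_continuousAt.2 fun t => (h.hasDerivAt_U t).continuousAt

/-- Conservation of the Hamiltonian. -/
theorem IsSolution.energy (hα : 1 ≤ α) (h : IsSolution α v X U Y) (s t : ℝ) :
    U s ^ 2 + v ^ 2 * |X s| ^ (2 * α) = U t ^ 2 + v ^ 2 * |X t| ^ (2 * α) := by
  have hd : ∀ t, HasDerivAt (fun t => U t ^ 2 + v ^ 2 * |X t| ^ (2 * α)) 0 t := by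
    intro t
    have h1 := (hasDerivAt_abs_rpow_two_mul hα (X t)).comp t (h.hasDerivAt_X t)
    refine (((h.hasDerivAt_U t).pow 2).add (h1.const_mul (v ^ 2))).congr_deriv ?_
    push_cast
    ring
  exact is_const_of_deriv_eq_zero (fun t => (hd t).differentiableAt) (fun t => (hd t).deriv) s t

/-- The integrated form of Euler's relation: since the Hamiltonian is quasi-homogeneous, the
displacement in `y` is determined by the motion in `x`. -/
theorem IsSolution.displacement (hα : 1 ≤ α) (h : IsSolution α v X U Y) (t : ℝ) :
    (1 + α) * v * (Y t - Y 0) =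
      (U 0 ^ 2 + v ^ 2 * |X 0| ^ (2 * α)) * t - X t * U t + X 0 * U 0 := by
  have hd : ∀ t, HasDerivAt (fun t => (1 + α) * v * Y t -
      (U 0 ^ 2 + v ^ 2 * |X 0| ^ (2 * α)) * t + X t * U t) 0 t := by
    intro t
    refine ((((h.hasDerivAt_Y t).const_mul ((1 + α) * v)).sub ((hasDerivAt_id t).const_mul
      (U 0 ^ 2 + v ^ 2 * |X 0| ^ (2 * α)))).add
      ((h.hasDerivAt_X t).mul (h.hasDerivAt_U t))).congr_deriv ?_
    rw [h.energy hα 0 t]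
    linear_combination (-(α * v ^ 2)) * mul_force hα (X t)
  have := is_const_of_deriv_eq_zero (fun t => (hd t).differentiableAt) (fun t => (hd t).deriv) t 0
  simp only [mul_zero, sub_zero] at this
  linear_combination this

/-- The equation is invariant under affine changes of time and under the dilations of the Grushin
plane. -/
theorem IsSolution.rescale (h : IsSolution α v X U Y) {a : ℝ} (ha : 0 < a)
    (b c y : ℝ) : IsSolution α (v * b * a ^ (1 - α)) (fun t => a * X (b * t + c))
      (fun t => a * b * U (b * t + c)) (fun t => y + a ^ (1 + α) * (Y (b * t + c) - Y c)) := by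
  have hl : ∀ t : ℝ, HasDerivAt (fun t => b * t + c) b t := fun t => by
    simpa using ((hasDerivAt_id t).const_mul b).add_const c
  have ha2 : a ^ (1 - α) * a ^ (1 - α) * a ^ (2 * α - 1) = a := by
    rw [← Real.rpow_add ha, ← Real.rpow_add ha]
    conv_rhs => rw [← Real.rpow_one a]
    congr 1
    ring
  have ha3 : a ^ (1 - α) * a ^ (2 * α) = a ^ (1 + α) := by
    rw [← Real.rpow_add ha]
    congr 1
    ring
  refine ⟨fun t => ?_, fun t => ?_, fun t => ?_⟩
  · refine (((h.hasDerivAt_X _).comp t (hl t)).const_mul a).congr_deriv ?_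
    ring
  · refine (((h.hasDerivAt_U _).comp t (hl t)).const_mul (a * b)).congr_deriv ?_
    rw [force_mul ha]
    linear_combination (α * v ^ 2 * b ^ 2 * force α (X (b * t + c))) * ha2
  · refine ((((h.hasDerivAt_Y _).comp t (hl t)).sub_const (Y c)).const_mul
      (a ^ (1 + α))).const_add y |>.congr_deriv ?_
    rw [abs_mul, abs_of_pos ha, Real.mul_rpow ha.le (abs_nonneg _)]
    linear_combination (-(v * b * |X (b * t + c)| ^ (2 * α))) * ha3

theorem contDiff_planarField (hα : 1 ≤ α) (v : ℝ) :
    ContDiff ℝ 1 fun z : ℝ × ℝ => (z.2, -(α * v ^ 2 * force α z.1)) :=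
  contDiff_snd.prodMk (contDiff_const.mul ((contDiff_force hα).comp contDiff_fst)).neg

theorem exists_isSolution (hα : 1 ≤ α) (v x₀ u₀ y₀ : ℝ) :
    ∃ X U Y : ℝ → ℝ, IsSolution α v X U Y ∧ X 0 = x₀ ∧ U 0 = u₀ ∧ Y 0 = y₀ := by
  rcases eq_or_ne v 0 with rfl | hv
  · refine ⟨fun t => x₀ + u₀ * t, fun _ => u₀, fun _ => y₀, ⟨fun t => ?_, fun t => ?_, fun t => ?_⟩,
      by simp, rfl, rfl⟩
    · simpa using ((hasDerivAt_id t).const_mul u₀).const_add x₀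
    · simpa using hasDerivAt_const t u₀
    · simpa using hasDerivAt_const t y₀
  · have hα0 : 0 < 2 * α := by linarith
    have hv2 : 0 < v ^ 2 := by positivity
    let H : ℝ × ℝ → ℝ := fun z => z.2 ^ 2 + v ^ 2 * |z.1| ^ (2 * α)
    have hH : ∀ z : ℝ × ℝ, HasFDerivAt H ((2 * z.2) • ContinuousLinearMap.snd ℝ ℝ ℝ +
        (v ^ 2 * (2 * α * force α z.1)) • ContinuousLinearMap.fst ℝ ℝ ℝ) z := by
      intro z
      have h1 := (hasDerivAt_pow 2 z.2).comp_hasFDerivAt z (hasFDerivAt_snd (𝕜 := ℝ) (p := z))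
      have h2 := ((hasDerivAt_abs_rpow_two_mul hα z.1).const_mul (v ^ 2)).comp_hasFDerivAt z
        (hasFDerivAt_fst (𝕜 := ℝ) (p := z))
      refine (h1.add h2).congr_fderiv ?_
      simp
    have hbound : ∀ z, H z = H (x₀, u₀) → ‖z‖ ≤ max ((H (x₀, u₀) / v ^ 2) ^ (1 / (2 * α)))
        √(H (x₀, u₀)) := by
      intro z hz
      have h1 : 0 ≤ v ^ 2 * |z.1| ^ (2 * α) := by positivity
      have h2 : 0 ≤ z.2 ^ 2 := by positivity
      rw [Prod.norm_def]
      refine max_le_max ?_ ?_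
      · rw [Real.norm_eq_abs]
        have h3 : |z.1| ^ (2 * α) ≤ H (x₀, u₀) / v ^ 2 := by
          rw [le_div_iff₀ hv2, ← hz]
          simp only [H]
          linarith
        have h4 := Real.rpow_le_rpow (by positivity) h3 (z := 1 / (2 * α)) (by positivity)
        rwa [← Real.rpow_mul (abs_nonneg _), mul_one_div_cancel hα0.ne', Real.rpow_one] at h4
      · rw [Real.norm_eq_abs]
        refine Real.abs_le_sqrt ?_
        rw [← hz]
        simp only [H]
        linarith
    obtain ⟨γ, hγ0, hγ⟩ := exists_solution_of_first_integral (contDiff_planarField hα v)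
      (H := H) (fun z => (hH z).differentiableAt) (fun z => by
        rw [(hH z).fderiv]
        simp
        ring) hbound
    have hX : ∀ t, HasDerivAt (fun t => (γ t).1) (γ t).2 t := fun t => (hγ t).fst
    have hU : ∀ t, HasDerivAt (fun t => (γ t).2) (-(α * v ^ 2 * force α (γ t).1)) t :=
      fun t => (hγ t).snd
    have hXc : Continuous fun t => (γ t).1 :=
      continuous_iff_continuousAt.2 fun t => (hX t).continuousAt
    have hc : Continuous fun t => v * |(γ t).1| ^ (2 * α) :=
      continuous_const.mul ((contDiff_abs_rpow_two_mul hα).continuous.comp hXc)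
    refine ⟨fun t => (γ t).1, fun t => (γ t).2,
      fun t => y₀ + ∫ s in (0 : ℝ)..t, v * |(γ s).1| ^ (2 * α), ⟨hX, hU, fun t => ?_⟩, ?_, ?_, ?_⟩
    · exact (intervalIntegral.integral_hasDerivAt_right (hc.intervalIntegrable _ _)
        (hc.stronglyMeasurableAtFilter _ _) hc.continuousAt).const_add y₀
    · simp [hγ0]
    · simp [hγ0]
    · simp

/-- A solution is smooth as long as it does not meet the singular line `x = 0`. -/
theorem IsSolution.contDiffOn (h : IsSolution α v X U Y) (n : ℕ) :
    ContDiffOn ℝ n X {t | X t ≠ 0} ∧ ContDiffOn ℝ n U {t | X t ≠ 0} ∧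
      ContDiffOn ℝ n Y {t | X t ≠ 0} := by
  have ho : IsOpen {t | X t ≠ 0} := isOpen_ne_fun h.continuous_X continuous_const
  induction n with
  | zero =>
    simp only [CharP.cast_eq_zero, contDiffOn_zero]
    exact ⟨h.continuous_X.continuousOn, h.continuous_U.continuousOn,
      fun t _ => (h.hasDerivAt_Y t).continuousAt.continuousWithinAt⟩
  | succ n ih =>
    obtain ⟨h1, h2, -⟩ := ih
    have key : ∀ {f f' : ℝ → ℝ}, (∀ t, HasDerivAt f (f' t) t) → ContDiffOn ℝ n f' {t | X t ≠ 0} →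
        ContDiffOn ℝ (n + 1 : ℕ) f {t | X t ≠ 0} := by
      intro f f' hf hf'
      push_cast
      rw [contDiffOn_succ_iff_deriv_of_isOpen ho]
      refine ⟨fun t _ => (hf t).differentiableAt.differentiableWithinAt, by simp, ?_⟩
      rwa [show deriv f = f' from funext fun t => (hf t).deriv]
    refine ⟨key h.hasDerivAt_X h2, key h.hasDerivAt_U ?_, key h.hasDerivAt_Y ?_⟩
    · refine (contDiffOn_const.mul ?_).neg
      exact fun t ht => ((contDiffAt_force (α := α) ht).of_le
        (by exact_mod_cast le_top)).comp_contDiffWithinAt t (h1 t ht)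
    · refine contDiffOn_const.mul ?_
      exact fun t ht => ((contDiffAt_abs_rpow ht (2 * α)).of_le
        (by exact_mod_cast le_top)).comp_contDiffWithinAt t (h1 t ht)

theorem IsSolution.smoothNear (h : IsSolution α v X U Y) {t : ℝ} (ht : X t ≠ 0) :
    SmoothNear X t ∧ SmoothNear U t ∧ SmoothNear Y t := by
  have ho : IsOpen {t | X t ≠ 0} := isOpen_ne_fun h.continuous_X continuous_const
  have hm : ∀ᶠ s in 𝓝 t, {t | X t ≠ 0} ∈ 𝓝 s := eventually_mem_nhds_iff.2 (ho.mem_nhds ht)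
  refine ⟨hm.mono fun s hs => ?_, hm.mono fun s hs => ?_, hm.mono fun s hs => ?_⟩
  · exact contDiffAt_infty.2 fun n => (h.contDiffOn n).1.contDiffAt hs
  · exact contDiffAt_infty.2 fun n => (h.contDiffOn n).2.1.contDiffAt hs
  · exact contDiffAt_infty.2 fun n => (h.contDiffOn n).2.2.contDiffAt hs

end IsSolution

/-! ### The exponential map -/

theorem hamiltonian_grushin (α : ℝ) (z : (ℝ × ℝ) × (ℝ × ℝ)) :
    SubRiem.hamiltonian (SubRiem.grushin α) z =
      1 / 2 * (z.2.1 ^ 2 + z.2.2 ^ 2 * |z.1.1| ^ (2 * α)) := by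
  have : |z.1.1| ^ (2 * α) = (|z.1.1| ^ α) ^ 2 := by
    rw [← Real.rpow_natCast, ← Real.rpow_mul (abs_nonneg _)]
    congr 1
    push_cast
    ring
  simp [SubRiem.hamiltonian, SubRiem.grushin, SubRiem.pairing, this]
  ring

theorem hamiltonianVectorField_grushin {α : ℝ} (hα : 1 ≤ α) (z : (ℝ × ℝ) × (ℝ × ℝ)) :
    SubRiem.hamiltonianVectorField (SubRiem.hamiltonian (SubRiem.grushin α)) z =
      ((z.2.1, z.2.2 * |z.1.1| ^ (2 * α)), (-(α * z.2.2 ^ 2 * force α z.1.1), 0)) := by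
  have hx : HasFDerivAt (fun z : (ℝ × ℝ) × (ℝ × ℝ) => z.1.1)
      ((ContinuousLinearMap.fst ℝ ℝ ℝ).comp (ContinuousLinearMap.fst ℝ (ℝ × ℝ) (ℝ × ℝ))) z :=
    hasFDerivAt_fst.fst
  have hu : HasFDerivAt (fun z : (ℝ × ℝ) × (ℝ × ℝ) => z.2.1)
      ((ContinuousLinearMap.fst ℝ ℝ ℝ).comp (ContinuousLinearMap.snd ℝ (ℝ × ℝ) (ℝ × ℝ))) z :=
    hasFDerivAt_snd.fst
  have hv : HasFDerivAt (fun z : (ℝ × ℝ) × (ℝ × ℝ) => z.2.2)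
      ((ContinuousLinearMap.snd ℝ ℝ ℝ).comp (ContinuousLinearMap.snd ℝ (ℝ × ℝ) (ℝ × ℝ))) z :=
    hasFDerivAt_snd.snd
  have h1 := ((hu.pow 2).add ((hv.pow 2).mul
    ((hasDerivAt_abs_rpow_two_mul hα z.1.1).comp_hasFDerivAt z hx))).const_mul (1 / 2)
  have h2 : fderiv ℝ (SubRiem.hamiltonian (SubRiem.grushin α)) z = _ :=
    (h1.congr_of_eventuallyEq (Eventually.of_forall fun z => hamiltonian_grushin α z)).fderiv
  rw [SubRiem.hamiltonianVectorField, h2]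
  ext <;> simp <;> ring

theorem contDiff_hamiltonianVectorField {α : ℝ} (hα : 1 ≤ α) :
    ContDiff ℝ 1 (SubRiem.hamiltonianVectorField (SubRiem.hamiltonian (SubRiem.grushin α))) := by
  rw [funext (hamiltonianVectorField_grushin hα)]
  have h1 := contDiff_abs_rpow_two_mul hα
  have h2 := contDiff_force hα
  have hx : ContDiff ℝ 1 fun z : (ℝ × ℝ) × (ℝ × ℝ) => z.1.1 := by fun_prop
  exact (ContDiff.prodMk (by fun_prop) ((by fun_prop : ContDiff ℝ 1
    fun z : (ℝ × ℝ) × (ℝ × ℝ) => z.2.2).mul (h1.comp hx))).prodMk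
    (ContDiff.prodMk ((ContDiff.mul (by fun_prop) (h2.comp hx)).neg) contDiff_const)

theorem IsSolution.isNormalExtremal {α v : ℝ} {X U Y : ℝ → ℝ} (hα : 1 ≤ α)
    (h : IsSolution α v X U Y) :
    SubRiem.IsNormalExtremal (SubRiem.grushin α) fun t => ((X t, Y t), (U t, v)) := by
  intro t _
  rw [hamiltonianVectorField_grushin hα]
  exact (((h.hasDerivAt_X t).prodMk (h.hasDerivAt_Y t)).prodMk
    ((h.hasDerivAt_U t).prodMk (hasDerivAt_const t v))).hasDerivWithinAt

theorem expDomain_grushin {α : ℝ} (hα : 1 ≤ α) (q p : ℝ × ℝ) :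
    p ∈ SubRiem.expDomain (SubRiem.grushin α) q := by
  obtain ⟨X, U, Y, h, hX, hU, hY⟩ := exists_isSolution hα p.2 q.1 p.1 q.2
  exact ⟨_, h.isNormalExtremal hα, by rw [hX, hU, hY]⟩

theorem IsSolution.expMap_eq {α v : ℝ} {X U Y : ℝ → ℝ} (hα : 1 ≤ α) (h : IsSolution α v X U Y) :
    SubRiem.expMap (SubRiem.grushin α) (X 0, Y 0) (U 0, v) = (X 1, Y 1) := by
  have hd := expDomain_grushin hα (X 0, Y 0) (U 0, v)
  rw [SubRiem.expMap, dif_pos hd]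
  have h1 := eqOn_of_solution (contDiff_hamiltonianVectorField hα) hd.choose_spec.1
    (h.isNormalExtremal hα) hd.choose_spec.2 ⟨zero_le_one, le_rfl⟩
  rw [h1]

/-! ### Transport of differentiability through a change of coordinates -/

theorem SmoothNear.rpow_const {E : Type*} [NormedAddCommGroup E] [NormedSpace ℝ E] {f : E → ℝ}
    {p : E} (hf : SmoothNear f p) (h0 : f p ≠ 0) (β : ℝ) : SmoothNear (fun z => f z ^ β) p := by
  filter_upwards [hf, hf.continuousAt.eventually_ne h0] with z h1 h2
  exact h1.rpow_const_of_ne h2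

/-- If `f ∘ Φ = Ψ` near `z`, with `Φ` a local diffeomorphism, then `f` is differentiable at `Φ z`
when `Ψ` is at `z`. -/
theorem SmoothNear.exists_hasFDerivAt_of_comp_eq {f Φ Ψ : ℝ × ℝ → ℝ × ℝ} {z : ℝ × ℝ}
    {Φ' Ψ' : ℝ × ℝ →L[ℝ] ℝ × ℝ} (hΦ : SmoothNear Φ z) (hΦ' : HasFDerivAt Φ Φ' z)
    (hd : Φ'.det ≠ 0) (hΨ : HasFDerivAt Ψ Ψ' z) (h : ∀ᶠ w in 𝓝 z, f (Φ w) = Ψ w) :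
    ∃ f' : ℝ × ℝ →L[ℝ] ℝ × ℝ, HasFDerivAt f f' (Φ z) ∧ f'.comp Φ' = Ψ' := by
  obtain ⟨g, hg, hg0, hΦg, -⟩ := hΦ.exists_local_inverse (by rwa [hΦ'.fderiv])
  have hgc : Tendsto g (𝓝 (Φ z)) (𝓝 z) := by
    have := hg.continuousAt.tendsto
    rwa [hg0] at this
  have hfg : f =ᶠ[𝓝 (Φ z)] fun w => Ψ (g w) := by
    filter_upwards [hΦg, hgc.eventually h] with w h1 h2
    rw [← h2, h1]
  have hΨ0 : HasFDerivAt Ψ Ψ' (g (Φ z)) := by rwa [hg0]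
  have hf := (hΨ0.comp (Φ z) hg.differentiableAt.hasFDerivAt).congr_of_eventuallyEq hfg
  exact ⟨_, hf, (hf.comp z hΦ').unique (hΨ.congr_of_eventuallyEq h)⟩

/-- If `f ∘ Φ = Ψ` near `z`, with `Φ` a local diffeomorphism, then `f` is smooth near `Φ z` when
`Ψ` is near `z`. -/
theorem SmoothNear.of_comp_eq {f Φ Ψ : ℝ × ℝ → ℝ × ℝ} {z : ℝ × ℝ} (hΦ : SmoothNear Φ z)
    (hd : (fderiv ℝ Φ z).det ≠ 0) (hΨ : SmoothNear Ψ z) (h : ∀ᶠ w in 𝓝 z, f (Φ w) = Ψ w) :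
    SmoothNear f (Φ z) := by
  obtain ⟨g, hg, hg0, hΦg, -⟩ := hΦ.exists_local_inverse hd
  have hgc : Tendsto g (𝓝 (Φ z)) (𝓝 z) := by
    have := hg.continuousAt.tendsto
    rwa [hg0] at this
  refine (hΨ.comp_of_eq hg hg0).congr ?_
  filter_upwards [hΦg, hgc.eventually h] with w h1 h2
  rw [← h2, h1]

/-- The linear map with matrix `!![a, b; c, d]`. -/
noncomputable def lin (a b c d : ℝ) : ℝ × ℝ →L[ℝ] ℝ × ℝ :=
  (a • ContinuousLinearMap.fst ℝ ℝ ℝ + b • ContinuousLinearMap.snd ℝ ℝ ℝ).prod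
    (c • ContinuousLinearMap.fst ℝ ℝ ℝ + d • ContinuousLinearMap.snd ℝ ℝ ℝ)

theorem lin_apply (a b c d : ℝ) (z : ℝ × ℝ) :
    lin a b c d z = (a * z.1 + b * z.2, c * z.1 + d * z.2) := by
  simp [lin]

theorem det_lin (a b c d : ℝ) : (lin a b c d).det = a * d - b * c := by
  rw [det_eq]
  simp [lin_apply]

/-! ### Coordinates on the covectors given by the symmetries -/

/-- A one-parameter family of symmetries (a time shift by `-X 0 * σ` followed by a dilation of
ratio `a σ`) which keeps the initial abscissa fixed along the solution. Together with the changes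
of the time scale it parametrizes the covectors near the initial one. When `X 0 = 0` there is no
shift, and the dilations alone form such a family; any `a` with `a 0 = 1` and `a' 0 = U 0` would do,
and this derivative makes the formulas uniform. -/
structure IsFamily (X U Y a : ℝ → ℝ) : Prop where
  zero : a 0 = 1
  hasDerivAt : HasDerivAt a (U 0) 0
  smooth : SmoothNear a 0
  smooth_U : SmoothNear (fun σ => U (-(X 0 * σ))) 0
  smooth_Y : SmoothNear (fun σ => Y (-(X 0 * σ))) 0
  mul_eq : ∀ᶠ σ in 𝓝 (0 : ℝ), a σ * X (-(X 0 * σ)) = X 0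

/-- The initial covector of the solution with dilation and time shift of parameter `z.1` and with
time multiplied by `z.2`. -/
noncomputable def covector (α v : ℝ) (X U a : ℝ → ℝ) (z : ℝ × ℝ) : ℝ × ℝ :=
  (a z.1 * z.2 * U (-(X 0 * z.1)), v * z.2 * a z.1 ^ (1 - α))

/-- The end-point of the solution with dilation and time shift of parameter `z.1` and with time
multiplied by `z.2`. -/
noncomputable def endpoint (α : ℝ) (X Y a : ℝ → ℝ) (z : ℝ × ℝ) : ℝ × ℝ :=
  (a z.1 * X (z.2 + -(X 0 * z.1)),
    Y 0 + a z.1 ^ (1 + α) * (Y (z.2 + -(X 0 * z.1)) - Y (-(X 0 * z.1))))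

section coordinates

variable {α v : ℝ} {X U Y a : ℝ → ℝ}

theorem IsSolution.exists_isFamily (h : IsSolution α v X U Y) : ∃ a, IsFamily X U Y a := by
  rcases eq_or_ne (X 0) 0 with h0 | h0
  · refine ⟨fun σ => 1 + U 0 * σ, by simp, ?_, ?_, ?_, ?_, ?_⟩
    · simpa using ((hasDerivAt_id (0 : ℝ)).const_mul (U 0)).const_add 1
    · exact smoothNear_of_contDiff (by fun_prop) _
    · simpa [h0] using smoothNear_const (U 0) (0 : ℝ)
    · simpa [h0] using smoothNear_const (Y 0) (0 : ℝ)
    · simp [h0]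
  · obtain ⟨hX, hU, hY⟩ := h.smoothNear h0
    have hc : SmoothNear (fun σ : ℝ => -(X 0 * σ)) 0 := smoothNear_of_contDiff (by fun_prop) _
    have hc0 : (fun σ : ℝ => -(X 0 * σ)) 0 = 0 := by simp
    have hXc : SmoothNear (fun σ => X (-(X 0 * σ))) 0 := hX.comp_of_eq hc hc0
    have hne : ∀ᶠ σ in 𝓝 (0 : ℝ), X (-(X 0 * σ)) ≠ 0 :=
      hXc.continuousAt.eventually_ne (by simpa using h0)
    refine ⟨fun σ => X 0 / X (-(X 0 * σ)), by simp [h0], ?_, ?_, hU.comp_of_eq hc hc0,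
      hY.comp_of_eq hc hc0, ?_⟩
    · have h1 : HasDerivAt (fun σ : ℝ => -(X 0 * σ)) (-X 0) 0 :=
        ((hasDerivAt_id (0 : ℝ)).const_mul (X 0)).neg.congr_deriv (by simp)
      have h2 := (h.hasDerivAt_X (-(X 0 * 0))).comp 0 h1
      refine ((hasDerivAt_const (0 : ℝ) (X 0)).div h2 (by simpa using h0)).congr_deriv ?_
      simp only [Function.comp_apply, mul_zero, neg_zero]
      field_simp
      ring
    · filter_upwards [hXc, hne] with σ h1 h2
      exact contDiffAt_const.div h1 h2
    · filter_upwards [hne] with σ h1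
      exact div_mul_cancel₀ _ h1

theorem covector_base (ha : IsFamily X U Y a) : covector α v X U a (0, 1) = (U 0, v) := by
  simp [covector, ha.zero]

theorem IsFamily.eventually_pos (ha : IsFamily X U Y a) : ∀ᶠ σ in 𝓝 (0 : ℝ), 0 < a σ :=
  ha.smooth.continuousAt.eventually (lt_mem_nhds (by simp [ha.zero]))

theorem IsSolution.expMap_covector (hα : 1 ≤ α) (h : IsSolution α v X U Y) {z : ℝ × ℝ}
    (hpos : 0 < a z.1) (hmul : a z.1 * X (-(X 0 * z.1)) = X 0) :
    SubRiem.expMap (SubRiem.grushin α) (X 0, Y 0) (covector α v X U a z) =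
      endpoint α X Y a z := by
  have h1 := (h.rescale hpos z.2 (-(X 0 * z.1)) (Y 0)).expMap_eq hα
  simp only [mul_zero, zero_add, sub_self, add_zero, mul_one] at h1
  rw [hmul] at h1
  exact h1

theorem eventually_fst {P : ℝ → Prop} (h : ∀ᶠ σ in 𝓝 (0 : ℝ), P σ) (b : ℝ) :
    ∀ᶠ z in 𝓝 ((0 : ℝ), b), P z.1 :=
  (continuous_fst.tendsto ((0 : ℝ), b)).eventually h

theorem IsSolution.eventually_expMap_covector (hα : 1 ≤ α) (h : IsSolution α v X U Y)
    (ha : IsFamily X U Y a) : ∀ᶠ z in 𝓝 ((0 : ℝ), (1 : ℝ)),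
      SubRiem.expMap (SubRiem.grushin α) (X 0, Y 0) (covector α v X U a z) =
        endpoint α X Y a z := by
  filter_upwards [eventually_fst ha.eventually_pos 1, eventually_fst ha.mul_eq 1] with z h1 h2
  exact h.expMap_covector hα h1 h2

theorem IsFamily.smoothNear_covector (ha : IsFamily X U Y a) :
    SmoothNear (covector α v X U a) (0, 1) := by
  have h1 : SmoothNear (fun z : ℝ × ℝ => a z.1) (0, 1) :=
    ha.smooth.comp_of_eq (smoothNear_fst _) rfl
  have h2 : SmoothNear (fun z : ℝ × ℝ => U (-(X 0 * z.1))) (0, 1) :=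
    ha.smooth_U.comp_of_eq (smoothNear_fst _) rfl
  exact ((h1.mul (smoothNear_snd _)).mul h2).prodMk
    (((smoothNear_const v _).mul (smoothNear_snd _)).mul (h1.rpow_const (by simp [ha.zero]) _))

theorem IsFamily.smoothNear_endpoint (ha : IsFamily X U Y a) (h : IsSolution α v X U Y)
    (h1 : X 1 ≠ 0) : SmoothNear (endpoint α X Y a) (0, 1) := by
  obtain ⟨hX, -, hY⟩ := h.smoothNear h1
  have h1 : SmoothNear (fun z : ℝ × ℝ => a z.1) (0, 1) :=
    ha.smooth.comp_of_eq (smoothNear_fst _) rfl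
  have h2 : SmoothNear (fun z : ℝ × ℝ => z.2 + -(X 0 * z.1)) (0, 1) :=
    smoothNear_of_contDiff (by fun_prop) _
  have h3 : SmoothNear (fun z : ℝ × ℝ => Y (-(X 0 * z.1))) (0, 1) :=
    ha.smooth_Y.comp_of_eq (smoothNear_fst _) rfl
  exact (h1.mul (hX.comp_of_eq h2 (by simp))).prodMk ((smoothNear_const _ _).add
    ((h1.rpow_const (by simp [ha.zero]) _).mul ((hY.comp_of_eq h2 (by simp)).sub h3)))

theorem hasFDerivAt_shift (x : ℝ) : HasFDerivAt (fun z : ℝ × ℝ => -(x * z.1))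
    (-(x • ContinuousLinearMap.fst ℝ ℝ ℝ)) (0, 1) :=
  (hasFDerivAt_fst.const_mul x).neg

/-- The determinant of this differential is `α * v` times `U 0 ^ 2 + v ^ 2 * |X 0| ^ (2 * α)`, so
that `covector` is a local diffeomorphism, also on the singular line. -/
theorem IsFamily.hasFDerivAt_covector (hα : 1 ≤ α) (ha : IsFamily X U Y a)
    (h : IsSolution α v X U Y) :
    HasFDerivAt (covector α v X U a) (lin (U 0 ^ 2 + α * (v ^ 2 * |X 0| ^ (2 * α))) (U 0)
      (v * (1 - α) * U 0) v) (0, 1) := by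
  have h1 : HasFDerivAt (fun z : ℝ × ℝ => a z.1) (U 0 • ContinuousLinearMap.fst ℝ ℝ ℝ) (0, 1) :=
    ha.hasDerivAt.comp_hasFDerivAt ((0 : ℝ), (1 : ℝ)) hasFDerivAt_fst
  have h2 : HasFDerivAt (fun z : ℝ × ℝ => U (-(X 0 * z.1))) _ (0, 1) :=
    (h.hasDerivAt_U (-(X 0 * 0))).comp_hasFDerivAt ((0 : ℝ), (1 : ℝ)) (hasFDerivAt_shift (X 0))
  have h3 := h1.rpow_const (p := 1 - α) (Or.inl (by simp [ha.zero]))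
  have h4 : HasFDerivAt (fun z : ℝ × ℝ => z.2) (ContinuousLinearMap.snd ℝ ℝ ℝ) (0, 1) :=
    hasFDerivAt_snd
  refine (((h1.mul h4).mul h2).prodMk ((h4.const_mul v).mul h3)).congr_fderiv ?_
  ext <;> simp [lin, ha.zero, ← mul_force hα] <;> ring

theorem IsFamily.hasFDerivAt_endpoint (ha : IsFamily X U Y a) (h : IsSolution α v X U Y) :
    HasFDerivAt (endpoint α X Y a) (lin (U 0 * X 1 - X 0 * U 1) (U 1)
      ((1 + α) * U 0 * (Y 1 - Y 0) - X 0 * v * (|X 1| ^ (2 * α) - |X 0| ^ (2 * α)))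
      (v * |X 1| ^ (2 * α))) (0, 1) := by
  have h1 : HasFDerivAt (fun z : ℝ × ℝ => a z.1) (U 0 • ContinuousLinearMap.fst ℝ ℝ ℝ) (0, 1) :=
    ha.hasDerivAt.comp_hasFDerivAt ((0 : ℝ), (1 : ℝ)) hasFDerivAt_fst
  have h2 : HasFDerivAt (fun z : ℝ × ℝ => z.2 + -(X 0 * z.1)) _ (0, 1) :=
    hasFDerivAt_snd.add (hasFDerivAt_shift (X 0))
  have h3 : HasFDerivAt (fun z : ℝ × ℝ => X (z.2 + -(X 0 * z.1))) _ (0, 1) :=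
    (h.hasDerivAt_X (1 + -(X 0 * 0))).comp_hasFDerivAt ((0 : ℝ), (1 : ℝ)) h2
  have h4 : HasFDerivAt (fun z : ℝ × ℝ => Y (z.2 + -(X 0 * z.1))) _ (0, 1) :=
    (h.hasDerivAt_Y (1 + -(X 0 * 0))).comp_hasFDerivAt ((0 : ℝ), (1 : ℝ)) h2
  have h5 : HasFDerivAt (fun z : ℝ × ℝ => Y (-(X 0 * z.1))) _ (0, 1) :=
    (h.hasDerivAt_Y (-(X 0 * 0))).comp_hasFDerivAt ((0 : ℝ), (1 : ℝ)) (hasFDerivAt_shift (X 0))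
  have h6 := h1.rpow_const (p := 1 + α) (Or.inl (by simp [ha.zero]))
  refine ((h1.mul h3).prodMk ((h6.mul (h4.sub h5)).const_add (Y 0))).congr_fderiv ?_
  ext <;> simp [lin, ha.zero] <;> ring

/-- The Jacobian determinant of the exponential map. The right-hand side is the value at time `1` of
the variation of `X` generated by the symmetries, in the direction which fixes the initial point and
the energy. -/
theorem IsSolution.hasFDerivAt_expMap (hα : 1 ≤ α) (h : IsSolution α v X U Y) (hv : v ≠ 0)
    (he : U 0 ^ 2 + v ^ 2 * |X 0| ^ (2 * α) ≠ 0) :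
    DifferentiableAt ℝ (SubRiem.expMap (SubRiem.grushin α) (X 0, Y 0)) (U 0, v) ∧
      α * v ^ 2 * (fderiv ℝ (SubRiem.expMap (SubRiem.grushin α) (X 0, Y 0)) (U 0, v)).det =
        U 0 * X 1 - U 1 * (X 0 + U 0) := by
  obtain ⟨a, ha⟩ := h.exists_isFamily
  have hα0 : α ≠ 0 := by linarith
  have hdet : (lin (U 0 ^ 2 + α * (v ^ 2 * |X 0| ^ (2 * α))) (U 0) (v * (1 - α) * U 0) v).det =
      α * v * (U 0 ^ 2 + v ^ 2 * |X 0| ^ (2 * α)) := by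
    rw [det_lin]
    ring
  obtain ⟨f', hf', hcomp⟩ := ha.smoothNear_covector.exists_hasFDerivAt_of_comp_eq
    (ha.hasFDerivAt_covector hα h) (by rw [hdet]; positivity) (ha.hasFDerivAt_endpoint h)
    (h.eventually_expMap_covector hα ha)
  rw [covector_base ha] at hf'
  refine ⟨hf'.differentiableAt, ?_⟩
  rw [hf'.fderiv]
  have h1 := congrArg ContinuousLinearMap.det hcomp
  rw [det_comp, hdet, det_lin] at h1
  have h2 := h.displacement hα 1
  have h3 := h.energy hα 1 0
  have h4 : (U 0 ^ 2 + v ^ 2 * |X 0| ^ (2 * α)) * (α * v ^ 2 * f'.det) =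
      (U 0 ^ 2 + v ^ 2 * |X 0| ^ (2 * α)) * (U 0 * X 1 - U 1 * (X 0 + U 0)) := by
    linear_combination v * h1 - U 1 * U 0 * h2 + (U 0 * X 1) * h3
  exact mul_left_cancel₀ he h4

end coordinates

/-! ### Conjugate covectors are folds -/

section fold

variable {α v : ℝ} {X U Y : ℝ → ℝ}

/-- For positive states of equal energy, a larger ratio `x / u` means a larger `x` and a smaller
`u`, hence a larger value of `x ^ (2 * α) * x / u ^ 3`. -/
theorem not_lt_of_energy_eq (hα : 1 ≤ α) {w x₀ u₀ x₁ u₁ : ℝ} (hw : 0 < w) (hx₀ : 0 < x₀)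
    (hu₀ : 0 < u₀) (hx₁ : 0 < x₁) (hu₁ : 0 < u₁)
    (he : u₁ ^ 2 + w * x₁ ^ (2 * α) = u₀ ^ 2 + w * x₀ ^ (2 * α))
    (h : x₁ ^ (2 * α) * x₁ * u₀ ^ 3 = x₀ ^ (2 * α) * x₀ * u₁ ^ 3) : ¬ x₀ * u₁ < x₁ * u₀ := by
  intro hlt
  have hm : 0 < x₀ ^ (2 * α) := Real.rpow_pos_of_pos hx₀ _
  have hn : 0 < x₁ ^ (2 * α) := Real.rpow_pos_of_pos hx₁ _
  rcases le_or_gt u₁ u₀ with hu | hu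
  · have h1 : x₁ ^ (2 * α) * u₀ ^ 2 < x₀ ^ (2 * α) * u₁ ^ 2 := by
      by_contra! hc
      have h2 : x₀ ^ (2 * α) * u₁ ^ 2 * (x₀ * u₁) < x₁ ^ (2 * α) * u₀ ^ 2 * (x₁ * u₀) :=
        mul_lt_mul' hc hlt (by positivity) (by positivity)
      linarith
    have h2 : u₁ ^ 2 ≤ u₀ ^ 2 := by gcongr
    have h3 : x₁ ^ (2 * α) * u₀ ^ 2 < x₀ ^ (2 * α) * u₀ ^ 2 :=
      h1.trans_le (mul_le_mul_of_nonneg_left h2 hm.le)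
    have h4 := mul_lt_mul_of_pos_left (lt_of_mul_lt_mul_right h3 (by positivity)) hw
    linarith
  · have h1 : x₀ * u₁ < x₁ * u₁ := hlt.trans (mul_lt_mul_of_pos_left hu hx₁)
    have h2 : x₀ < x₁ := lt_of_mul_lt_mul_right h1 hu₁.le
    have h3 := mul_lt_mul_of_pos_left (Real.rpow_lt_rpow hx₀.le h2 (by linarith : 0 < 2 * α)) hw
    have h4 : u₀ ^ 2 < u₁ ^ 2 := by gcongr
    linarith

/-- For two states of equal energy, the function `|x| ^ (2 * α) * x / u ^ 3` of the state
determines the ratio `x / u`, since it is increasing in this ratio. -/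
theorem mul_eq_mul_of_energy_eq (hα : 1 ≤ α) {x₀ u₀ x₁ u₁ : ℝ} (hv : v ≠ 0) (hu₀ : u₀ ≠ 0)
    (hu₁ : u₁ ≠ 0) (hx₀ : x₀ ≠ 0) (hx₁ : x₁ ≠ 0)
    (he : u₁ ^ 2 + v ^ 2 * |x₁| ^ (2 * α) = u₀ ^ 2 + v ^ 2 * |x₀| ^ (2 * α))
    (h : |x₁| ^ (2 * α) * x₁ * u₀ ^ 3 = |x₀| ^ (2 * α) * x₀ * u₁ ^ 3) : x₁ * u₀ = x₀ * u₁ := by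
  have hw : 0 < v ^ 2 := by positivity
  have hm : 0 < |x₀| ^ (2 * α) := Real.rpow_pos_of_pos (abs_pos.2 hx₀) _
  have hn : 0 < |x₁| ^ (2 * α) := Real.rpow_pos_of_pos (abs_pos.2 hx₁) _
  have he' : |u₁| ^ 2 + v ^ 2 * |x₁| ^ (2 * α) = |u₀| ^ 2 + v ^ 2 * |x₀| ^ (2 * α) := by
    simpa only [sq_abs] using he
  have h' : |x₁| ^ (2 * α) * |x₁| * |u₀| ^ 3 = |x₀| ^ (2 * α) * |x₀| * |u₁| ^ 3 := by
    have := congrArg abs h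
    simpa only [abs_mul, abs_pow, abs_of_pos hm, abs_of_pos hn] using this
  have h1 := not_lt_of_energy_eq hα hw (abs_pos.2 hx₀) (abs_pos.2 hu₀) (abs_pos.2 hx₁)
    (abs_pos.2 hu₁) he' h'
  have h2 := not_lt_of_energy_eq hα hw (abs_pos.2 hx₁) (abs_pos.2 hu₁) (abs_pos.2 hx₀)
    (abs_pos.2 hu₀) he'.symm h'.symm
  have h3 : |x₁ * u₀| = |x₀ * u₁| := by
    rw [abs_mul, abs_mul]
    exact le_antisymm (not_lt.1 h1) (not_lt.1 h2)
  rcases abs_eq_abs.1 h3 with h4 | h4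
  · exact h4
  · exfalso
    have h5 : |x₁| ^ (2 * α) * u₀ ^ 2 * (x₁ * u₀) = |x₀| ^ (2 * α) * u₁ ^ 2 * (x₀ * u₁) := by
      linear_combination h
    rw [h4] at h5
    have h6 : (|x₁| ^ (2 * α) * u₀ ^ 2 + |x₀| ^ (2 * α) * u₁ ^ 2) * (x₀ * u₁) = 0 := by
      linear_combination -h5
    exact mul_ne_zero (by positivity) (mul_ne_zero hx₀ hu₁) h6

/-- The expression is, up to a non-zero factor, the derivative of the Jacobian determinant in the
direction of the kernel. -/
theorem deriv_jacobi_ne_zero (hα : 1 ≤ α) {x₀ u₀ x₁ u₁ : ℝ} (hv : v ≠ 0)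
    (he : u₁ ^ 2 + v ^ 2 * |x₁| ^ (2 * α) = u₀ ^ 2 + v ^ 2 * |x₀| ^ (2 * α))
    (hJ : u₀ * x₁ - u₁ * (x₀ + u₀) = 0) (hx₁ : x₁ ≠ 0) (hu₀ : u₀ ≠ 0) :
    force α x₁ * (x₀ + u₀) ^ 2 + |x₀| ^ (2 * α) * (u₁ - x₁) ≠ 0 := by
  intro h0
  rcases eq_or_ne x₀ 0 with rfl | hx₀
  · rw [abs_zero, Real.zero_rpow (by linarith), zero_mul, add_zero, zero_add] at h0
    exact mul_ne_zero (force_ne_zero hx₁) (pow_ne_zero 2 hu₀) h0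
  · have hu₁ : u₁ ≠ 0 := by
      rintro rfl
      rw [zero_mul, sub_zero] at hJ
      exact mul_ne_zero hu₀ hx₁ hJ
    -- eliminate `x₀ + u₀ = u₀ * x₁ / u₁`
    have h1 : |x₁| ^ (2 * α) * x₁ * u₀ ^ 3 = |x₀| ^ (2 * α) * x₀ * u₁ ^ 3 := by
      rw [← mul_force hα x₁]
      linear_combination (u₀ * u₁ ^ 2) * h0 + (force α x₁ * u₀) *
        (u₀ * x₁ + u₁ * (x₀ + u₀)) * hJ + |x₀| ^ (2 * α) * u₁ ^ 2 * hJ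
    have h2 := mul_eq_mul_of_energy_eq hα hv hu₀ hu₁ hx₀ hx₁ he h1
    exact mul_ne_zero hu₀ hu₁ (by linear_combination h2 - hJ)

/-- The kernel of the differential is the direction along which the energy is constant; the
derivative of the Jacobian determinant in this direction is obtained by applying the formula for
the determinant along a curve of covectors with this velocity. -/
theorem IsSolution.foldCriterion (hα : 1 ≤ α) (h : IsSolution α v X U Y) (hv : v ≠ 0)
    (hU : U 0 ≠ 0) (hX : X 1 ≠ 0) (hJ : U 0 * X 1 - U 1 * (X 0 + U 0) = 0) :
    ∃ k, FoldCriterion (SubRiem.expMap (SubRiem.grushin α) (X 0, Y 0)) (U 0, v) k := by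
  obtain ⟨a, ha⟩ := h.exists_isFamily
  have hα0 : 0 < α := by linarith
  have he : 0 < U 0 ^ 2 + v ^ 2 * |X 0| ^ (2 * α) := by positivity
  have hΦ' := ha.hasFDerivAt_covector hα h
  have hΨ' := ha.hasFDerivAt_endpoint h
  set f := SubRiem.expMap (SubRiem.grushin α) (X 0, Y 0) with hf
  have hdet : (lin (U 0 ^ 2 + α * (v ^ 2 * |X 0| ^ (2 * α))) (U 0) (v * (1 - α) * U 0) v).det =
      α * v * (U 0 ^ 2 + v ^ 2 * |X 0| ^ (2 * α)) := by
    rw [det_lin]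
    ring
  have hdet0 : (lin (U 0 ^ 2 + α * (v ^ 2 * |X 0| ^ (2 * α))) (U 0)
      (v * (1 - α) * U 0) v).det ≠ 0 := by rw [hdet]; positivity
  have hcomp := h.eventually_expMap_covector hα ha
  have hsmooth : SmoothNear f (U 0, v) := by
    have := ha.smoothNear_covector.of_comp_eq (by rwa [hΦ'.fderiv])
      (ha.smoothNear_endpoint h hX) hcomp
    rwa [covector_base ha] at this
  obtain ⟨f', hf', hff⟩ := ha.smoothNear_covector.exists_hasFDerivAt_of_comp_eq hΦ' hdet0 hΨ' hcomp
  rw [covector_base ha] at hf'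
  set k := lin (U 0 ^ 2 + α * (v ^ 2 * |X 0| ^ (2 * α))) (U 0) (v * (1 - α) * U 0) v (1, -U 0)
    with hk
  have hδ := hsmooth.det_fderiv.differentiableAt.hasFDerivAt
  refine ⟨k, hsmooth, ?_, ?_, ?_⟩
  · rw [hk, lin_apply]
    intro h0
    have h1 := congrArg Prod.snd h0
    simp only [mul_one, Prod.snd_zero] at h1
    have h2 : α * (v * U 0) = 0 := by linear_combination -h1
    exact mul_ne_zero hα0.ne' (mul_ne_zero hv hU) h2
  · rw [hf'.fderiv]
    have h1 := DFunLike.congr_fun hff (1, -U 0)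
    rw [ContinuousLinearMap.comp_apply, ← hk, lin_apply] at h1
    rw [h1]
    have h2 := h.displacement hα 1
    have h3 := h.energy hα 1 0
    ext
    · simp only [mul_one, Prod.fst_zero]
      linear_combination hJ
    · simp only [mul_one, Prod.snd_zero]
      refine mul_left_cancel₀ hv ?_
      linear_combination U 0 * h2 - (X 0 + U 0) * h3 - U 1 * hJ
  · intro h0
    -- the curve of covectors, and the Jacobian determinant along it
    let c : ℝ → ℝ × ℝ := fun t => (t, 1 - U 0 * t)
    have hc0 : c 0 = (0, 1) := by simp [c]
    have hc : HasDerivAt c (1, -U 0) 0 := by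
      refine (hasDerivAt_id (0 : ℝ)).prodMk ?_
      simpa using ((hasDerivAt_id (0 : ℝ)).const_mul (U 0)).const_sub 1
    have hΦc : HasDerivAt (fun t => covector α v X U a (c t)) k 0 := by
      have h1 := hΦ'
      rw [← hc0] at h1
      exact h1.comp_hasDerivAt 0 hc
    have hΦc0 : covector α v X U a (c 0) = (U 0, v) := by rw [hc0, covector_base ha]
    have hj : HasDerivAt (fun t => (fderiv ℝ f (covector α v X U a (c t))).det) 0 0 := by
      rw [← hΦc0] at hδ
      have h1 := hδ.comp_hasDerivAt (0 : ℝ) hΦc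
      rw [hΦc0, h0] at h1
      exact h1
    have hdet_base : (fderiv ℝ f (U 0, v)).det = 0 := by
      have h1 := (h.hasFDerivAt_expMap hα hv he.ne').2
      rw [hJ] at h1
      exact (mul_eq_zero.1 h1).resolve_left (by positivity)
    have hjac : ∀ᶠ t in 𝓝 (0 : ℝ), α * (covector α v X U a (c t)).2 ^ 2 *
        (fderiv ℝ f (covector α v X U a (c t))).det = a t ^ 2 * (1 - U 0 * t) *
        (U (-(X 0 * t)) * X (1 - U 0 * t + -(X 0 * t)) - U (1 - U 0 * t + -(X 0 * t)) *
          (X (-(X 0 * t)) + (1 - U 0 * t) * U (-(X 0 * t)))) := by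
      have hUc : ∀ᶠ t in 𝓝 (0 : ℝ), U (-(X 0 * t)) ≠ 0 :=
        ha.smooth_U.continuousAt.eventually_ne (by simpa using hU)
      have hbc : ∀ᶠ t in 𝓝 (0 : ℝ), 1 - U 0 * t ≠ 0 := by
        have : ContinuousAt (fun t : ℝ => 1 - U 0 * t) 0 := by fun_prop
        exact this.eventually_ne (by simp)
      filter_upwards [ha.eventually_pos, ha.mul_eq, hUc, hbc] with t h1 h2 h3 h4
      have h5 := h.rescale h1 (1 - U 0 * t) (-(X 0 * t)) (Y 0)
      have h6 : a t ^ (1 - α) ≠ 0 := (Real.rpow_pos_of_pos h1 _).ne'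
      have h7 := (h5.hasFDerivAt_expMap hα (mul_ne_zero (mul_ne_zero hv h4) h6) (by
        simp only [mul_zero, zero_add]
        positivity)).2
      simp only [mul_zero, zero_add, sub_self, add_zero, mul_one] at h7
      rw [h2] at h7
      refine h7.trans ?_
      linear_combination (U (1 - U 0 * t + -(X 0 * t)) * a t * (1 - U 0 * t)) * h2
    have hleft : HasDerivAt (fun t => α * (covector α v X U a (c t)).2 ^ 2 *
        (fderiv ℝ f (covector α v X U a (c t))).det) 0 0 := by
      have hΦ2 : HasDerivAt (fun t => (covector α v X U a (c t)).2) k.2 0 := hΦc.snd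
      have h1 := (((hΦ2.pow 2).const_mul α).mul hj)
      refine h1.congr_deriv ?_
      rw [hΦc0, hdet_base]
      simp
    have hb : HasDerivAt (fun t : ℝ => 1 - U 0 * t) (-U 0) 0 := by
      simpa using ((hasDerivAt_id (0 : ℝ)).const_mul (U 0)).const_sub 1
    have hs : HasDerivAt (fun t : ℝ => -(X 0 * t)) (-X 0) 0 :=
      ((hasDerivAt_id (0 : ℝ)).const_mul (X 0)).neg.congr_deriv (by simp)
    have hbs : HasDerivAt (fun t : ℝ => 1 - U 0 * t + -(X 0 * t)) (-U 0 + -X 0) 0 := hb.add hs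
    have hXs := (h.hasDerivAt_X (-(X 0 * 0))).comp 0 hs
    have hUs := (h.hasDerivAt_U (-(X 0 * 0))).comp 0 hs
    have hXb := (h.hasDerivAt_X (1 - U 0 * 0 + -(X 0 * 0))).comp 0 hbs
    have hUb := (h.hasDerivAt_U (1 - U 0 * 0 + -(X 0 * 0))).comp 0 hbs
    have hright := ((ha.hasDerivAt.pow 2).mul hb).mul
      ((hUs.mul hXb).sub (hUb.mul (hXs.add (hb.mul hUs))))
    have h1 := (hleft.congr_of_eventuallyEq (hjac.mono fun _ ht => ht.symm)).unique hright
    simp only [Function.comp_apply, mul_zero, neg_zero, sub_zero, add_zero, ha.zero, one_pow,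
      one_mul, mul_one, Pi.mul_apply, Pi.sub_apply, Pi.add_apply, Pi.pow_apply, hJ, zero_add] at h1
    refine mul_ne_zero (by positivity : α * v ^ 2 ≠ 0)
      (deriv_jacobi_ne_zero hα hv (h.energy hα 1 0) hJ hX hU) ?_
    rw [← mul_force hα (X 0)]
    linear_combination h1

end fold

/-! ### Covectors with vanishing vertical momentum -/

/-- On the unit time interval, a solution with small vertical momentum `v` stays at distance
`O(v ^ 2)` of a straight line, uniformly for bounded initial velocities. -/
theorem exists_forall_abs_sub_le {α : ℝ} (hα : 1 ≤ α) (x₀ A : ℝ) :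
    ∃ R C : ℝ, |x₀| + A ≤ R ∧ 0 ≤ C ∧ ∀ (v : ℝ) (X U Y : ℝ → ℝ), IsSolution α v X U Y →
      X 0 = x₀ → |U 0| ≤ A → |v| ≤ 1 →
      ∀ t ∈ Icc (0 : ℝ) 1, |X t| ≤ R ∧ |X t - (x₀ + U 0 * t)| ≤ C * v ^ 2 := by
  set M := A ^ 2 + |x₀| ^ (2 * α) + 1 with hM
  have hp : 0 ≤ |x₀| ^ (2 * α) := by positivity
  have hM1 : 1 ≤ M := by rw [hM]; linarith [sq_nonneg A]
  have hAM : A ≤ M := by rw [hM]; nlinarith [sq_nonneg (A - 1)]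
  obtain ⟨D, hD⟩ := (isCompact_Icc (a := -(|x₀| + M)) (b := |x₀| + M)).exists_bound_of_continuousOn
    (continuous_force hα).continuousOn
  have hD0 : 0 ≤ D := (norm_nonneg _).trans (hD 0 ⟨by linarith [abs_nonneg x₀], by positivity⟩)
  refine ⟨|x₀| + M, α * D, by linarith, by positivity, fun v X U Y h hX hU hv => ?_⟩
  have hv2 : v ^ 2 ≤ 1 := by rwa [sq_le_one_iff_abs_le_one]
  have hUM : ∀ t, |U t| ≤ M := by
    intro t
    have h1 := h.energy hα t 0
    have h2 : 0 ≤ v ^ 2 * |X t| ^ (2 * α) := by positivity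
    have h3 : v ^ 2 * |x₀| ^ (2 * α) ≤ |x₀| ^ (2 * α) := mul_le_of_le_one_left hp hv2
    have h4 : U 0 ^ 2 ≤ A ^ 2 := by
      rw [← sq_abs]
      gcongr
    rw [hX] at h1
    refine abs_le_of_sq_le_sq ?_ (by linarith)
    nlinarith
  have key : ∀ {f f' : ℝ → ℝ} {B : ℝ}, (∀ t, HasDerivAt f (f' t) t) → 0 ≤ B →
      (∀ t ∈ Icc (0 : ℝ) 1, |f' t| ≤ B) → ∀ t ∈ Icc (0 : ℝ) 1, |f t - f 0| ≤ B := by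
    intro f f' B hf hB hb t ht
    have h1 := norm_image_sub_le_of_norm_deriv_le_segment' (a := 0) (b := 1)
      (fun t _ => (hf t).hasDerivWithinAt) (fun t ht => hb t (Ico_subset_Icc_self ht)) t ht
    rw [Real.norm_eq_abs, sub_zero] at h1
    exact h1.trans (mul_le_of_le_one_right hB ht.2)
  have hXR : ∀ t ∈ Icc (0 : ℝ) 1, |X t| ≤ |x₀| + M := by
    intro t ht
    have h1 := key h.hasDerivAt_X (by linarith) (fun t _ => hUM t) t ht
    rw [hX] at h1
    have h2 := abs_sub_abs_le_abs_sub (X t) x₀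
    linarith
  have hUC : ∀ t ∈ Icc (0 : ℝ) 1, |U t - U 0| ≤ α * D * v ^ 2 := by
    refine key h.hasDerivAt_U (by positivity) fun t ht => ?_
    have h1 : |force α (X t)| ≤ D := hD _ (abs_le.1 (hXR t ht))
    rw [abs_neg, abs_mul, abs_of_nonneg (by positivity : 0 ≤ α * v ^ 2)]
    calc α * v ^ 2 * |force α (X t)| ≤ α * v ^ 2 * D := by gcongr
      _ = α * D * v ^ 2 := by ring
  intro t ht
  refine ⟨hXR t ht, ?_⟩
  have h1 : ∀ t, HasDerivAt (fun t => X t - U 0 * t) (U t - U 0) t := fun t =>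
    ((h.hasDerivAt_X t).sub ((hasDerivAt_id t).const_mul (U 0))).congr_deriv (by simp)
  have h2 := key h1 (by positivity) hUC t ht
  simp only [mul_zero, sub_zero, hX] at h2
  rwa [show X t - (x₀ + U 0 * t) = X t - U 0 * t - x₀ by ring]

/-- Covectors `u₀ dx` with `u₀ ≠ 0` are not conjugate. As their geodesics are straight lines, the
differential of the exponential map there is diagonal, with entries `1` and the integral of
`|x| ^ (2 * α)` along the geodesic. -/
theorem det_fderiv_expMap_ne_zero {α : ℝ} (hα : 1 ≤ α) (q : ℝ × ℝ) {u₀ : ℝ} (hu₀ : u₀ ≠ 0) :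
    (fderiv ℝ (SubRiem.expMap (SubRiem.grushin α) q) (u₀, 0)).det ≠ 0 := by
  set f := SubRiem.expMap (SubRiem.grushin α) q with hf
  obtain ⟨x₀, y₀⟩ := q
  let P : ℝ → ℝ := fun x => |x| ^ (2 * α)
  have hP : ContDiff ℝ 1 P := contDiff_abs_rpow_two_mul hα
  have hPc : Continuous fun t : ℝ => P (x₀ + u₀ * t) := hP.continuous.comp (by fun_prop)
  let N : ℝ → ℝ := fun t => ∫ s in (0 : ℝ)..t, P (x₀ + u₀ * s)
  have hN : ∀ t, HasDerivAt N (P (x₀ + u₀ * t)) t := fun t =>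
    intervalIntegral.integral_hasDerivAt_right (hPc.intervalIntegrable _ _)
      (hPc.stronglyMeasurableAtFilter _ _) hPc.continuousAt
  have hN0 : N 0 = 0 := intervalIntegral.integral_same
  have hN1 : 0 < N 1 := by
    have hpos : ∀ x : ℝ, x ≠ 0 → 0 < P x := fun x hx => Real.rpow_pos_of_pos (abs_pos.2 hx) _
    refine intervalIntegral.integral_pos zero_lt_one hPc.continuousOn
      (fun t _ => Real.rpow_nonneg (abs_nonneg _) _) ?_
    by_cases h0 : x₀ = 0
    · exact ⟨1, ⟨zero_le_one, le_rfl⟩, hpos _ (by simpa [h0] using hu₀)⟩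
    · exact ⟨0, ⟨le_rfl, zero_le_one⟩, hpos _ (by simpa using h0)⟩
  obtain ⟨R, C, hR, hC, hbound⟩ := exists_forall_abs_sub_le hα x₀ (|u₀| + 1)
  obtain ⟨K, hK⟩ := (hP.contDiffOn (s := Icc (-R) R)).exists_lipschitzOnWith (by simp)
    (convex_Icc _ _) isCompact_Icc
  have hfd : HasFDerivAt f (lin 1 0 0 (N 1)) (u₀, 0) := by
    have hf0 : f (u₀, 0) = (x₀ + u₀, y₀) := by
      have h1 : IsSolution α 0 (fun t => x₀ + u₀ * t) (fun _ => u₀) (fun _ => y₀) := by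
        refine ⟨fun t => ?_, fun t => ?_, fun t => ?_⟩
        · simpa using ((hasDerivAt_id t).const_mul u₀).const_add x₀
        · simpa using hasDerivAt_const t u₀
        · simpa using hasDerivAt_const t y₀
      have h2 := h1.expMap_eq hα
      simpa using h2
    refine HasFDerivAt.of_isLittleO ((Asymptotics.IsBigO.of_bound (C + K * (1 + C))
      ?_).trans_isLittleO (Asymptotics.isLittleO_pow_sub_sub (u₀, (0 : ℝ)) one_lt_two))
    filter_upwards [closedBall_mem_nhds (u₀, (0 : ℝ)) one_pos] with p hp
    obtain ⟨u, v⟩ := p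
    have hnorm : ‖(u, v) - (u₀, (0 : ℝ))‖ = max |u - u₀| |v| := by
      simp [Prod.norm_def]
    rw [mem_closedBall, dist_eq_norm, hnorm, max_le_iff] at hp
    obtain ⟨X, U, Y, h, hX, hU, hY⟩ := exists_isSolution hα v x₀ u y₀
    have hu : |U 0| ≤ |u₀| + 1 := by
      rw [hU]
      linarith [abs_sub_abs_le_abs_sub u u₀]
    have hb := hbound v X U Y h hX hu hp.2
    have hfp : f (u, v) = (X 1, Y 1) := by
      have := h.expMap_eq hα
      rwa [hX, hY, hU] at this
    set m := max |u - u₀| |v| with hm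
    have hm0 : 0 ≤ m := (abs_nonneg v).trans (le_max_right _ _)
    have hvm : |v| ≤ m := le_max_right _ _
    have hum : |u - u₀| ≤ m := le_max_left _ _
    have hm1 : m ≤ 1 := max_le hp.1 hp.2
    have hv2 : v ^ 2 ≤ m ^ 2 := by
      rw [← sq_abs]
      gcongr
    have hx : |X 1 - (x₀ + u)| ≤ C * m ^ 2 := by
      have := (hb 1 ⟨zero_le_one, le_rfl⟩).2
      rw [hU, mul_one] at this
      exact this.trans (by gcongr)
    have hPX : ∀ t ∈ Icc (0 : ℝ) 1, |P (X t) - P (x₀ + u₀ * t)| ≤ K * ((1 + C) * m) := by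
      intro t ht
      obtain ⟨h1, h2⟩ := hb t ht
      rw [hU] at h2
      have h3 : |x₀ + u₀ * t| ≤ R := by
        have h4 : |u₀ * t| ≤ |u₀| := by
          rw [abs_mul, abs_of_nonneg ht.1]
          exact mul_le_of_le_one_right (abs_nonneg _) ht.2
        linarith [abs_add_le x₀ (u₀ * t)]
      have h5 := hK.dist_le_mul (X t) (abs_le.1 h1) (x₀ + u₀ * t) (abs_le.1 h3)
      rw [Real.dist_eq, Real.dist_eq] at h5
      refine h5.trans ?_
      have h6 : |(u - u₀) * t| ≤ m := by
        rw [abs_mul, abs_of_nonneg ht.1]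
        exact (mul_le_of_le_one_right (abs_nonneg _) ht.2).trans hum
      have h7 : X t - (x₀ + u₀ * t) = (X t - (x₀ + u * t)) + (u - u₀) * t := by ring
      have h8 : m ^ 2 ≤ m := by nlinarith
      have h9 : C * v ^ 2 ≤ C * m := by gcongr; exact hv2.trans h8
      have h10 : |X t - (x₀ + u₀ * t)| ≤ (1 + C) * m := by
        rw [h7]
        linarith [abs_add_le (X t - (x₀ + u * t)) ((u - u₀) * t)]
      gcongr
    have hy : |Y 1 - y₀ - v * N 1| ≤ K * (1 + C) * m ^ 2 := by
      have h1 : ∀ t, HasDerivAt (fun t => Y t - v * N t) (v * P (X t) - v * P (x₀ + u₀ * t)) t :=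
        fun t => (h.hasDerivAt_Y t).sub ((hN t).const_mul v)
      have h2 := norm_image_sub_le_of_norm_deriv_le_segment_01' (C := K * (1 + C) * m ^ 2)
        (fun t _ => (h1 t).hasDerivWithinAt) (fun t ht => by
          rw [← mul_sub, Real.norm_eq_abs, abs_mul]
          calc |v| * |P (X t) - P (x₀ + u₀ * t)| ≤ m * (K * ((1 + C) * m)) := by
                gcongr
                exact hPX t (Ico_subset_Icc_self ht)
            _ = K * (1 + C) * m ^ 2 := by ring)
      rw [Real.norm_eq_abs, hN0, hY] at h2
      rwa [show Y 1 - y₀ - v * N 1 = Y 1 - v * N 1 - (y₀ - v * 0) by ring]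
    rw [hfp, hf0, hnorm, lin_apply, norm_pow, Real.norm_eq_abs, abs_of_nonneg hm0]
    have hK0 : (0 : ℝ) ≤ K := K.2
    have e1 : (X 1, Y 1) - (x₀ + u₀, y₀) - (1 * ((u, v) - (u₀, (0 : ℝ))).1 +
        0 * ((u, v) - (u₀, (0 : ℝ))).2, 0 * ((u, v) - (u₀, (0 : ℝ))).1 +
        N 1 * ((u, v) - (u₀, (0 : ℝ))).2) = (X 1 - (x₀ + u), Y 1 - y₀ - v * N 1) := by
      ext <;> simp <;> ring
    rw [e1, Prod.norm_def]
    refine max_le (hx.trans ?_) (hy.trans ?_)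
    · have : 0 ≤ K * (1 + C) * m ^ 2 := by positivity
      linarith
    · have : 0 ≤ C * m ^ 2 := by positivity
      linarith
  rw [hfd.fderiv, det_lin]
  simpa using hN1.ne'

/-! ### The conjugate locus -/

section locus

variable {α v : ℝ} {X U Y : ℝ → ℝ}

/-- Explicit description of the non-trivial conjugate covectors. -/
theorem IsSolution.mem_nontrivialConjugateLocus_iff (hα : 1 ≤ α) (h : IsSolution α v X U Y) :
    (U 0, v) ∈ SubRiem.nontrivialConjugateLocus (SubRiem.grushin α) (X 0, Y 0) ↔
      v ≠ 0 ∧ U 0 ^ 2 + v ^ 2 * |X 0| ^ (2 * α) ≠ 0 ∧ U 0 * X 1 - U 1 * (X 0 + U 0) = 0 := by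
  have hα0 : 0 < α := by linarith
  have hH : SubRiem.hamiltonian (SubRiem.grushin α) ((X 0, Y 0), (U 0, v)) ≠ 0 ↔
      U 0 ^ 2 + v ^ 2 * |X 0| ^ (2 * α) ≠ 0 := by
    rw [hamiltonian_grushin]
    simp
  have hmem : (U 0, v) ∈ SubRiem.nontrivialConjugateLocus (SubRiem.grushin α) (X 0, Y 0) ↔
      (fderiv ℝ (SubRiem.expMap (SubRiem.grushin α) (X 0, Y 0)) (U 0, v)).det = 0 ∧
        U 0 ^ 2 + v ^ 2 * |X 0| ^ (2 * α) ≠ 0 := by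
    rw [← hH, ← mem_singularSet_iff]
    simp [SubRiem.nontrivialConjugateLocus, SubRiem.conjugateLocus, expDomain_grushin hα]
  rw [hmem]
  constructor
  · rintro ⟨h1, h2⟩
    have hv : v ≠ 0 := by
      rintro rfl
      have hU : U 0 ≠ 0 := by
        rintro hU
        simp [hU] at h2
      exact det_fderiv_expMap_ne_zero hα _ hU h1
    refine ⟨hv, h2, ?_⟩
    rw [← (h.hasFDerivAt_expMap hα hv h2).2, h1, mul_zero]
  · rintro ⟨hv, h2, h3⟩
    refine ⟨?_, h2⟩
    have h1 := (h.hasFDerivAt_expMap hα hv h2).2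
    rw [h3] at h1
    exact (mul_eq_zero.1 h1).resolve_left (by positivity)

/-- A function whose derivative has a constant sign on a punctured neighbourhood of a zero changes
sign at this zero. -/
theorem eventually_mul_sub_pos {f f' : ℝ → ℝ} (hf : ∀ t, HasDerivAt f (f' t) t) {t₀ s : ℝ}
    (h0 : f t₀ = 0) (hs : ∀ᶠ t in 𝓝[≠] t₀, 0 < s * f' t) :
    ∀ᶠ t in 𝓝[≠] t₀, 0 < s * f t * (t - t₀) := by
  rw [eventually_nhdsWithin_iff, Metric.eventually_nhds_iff_ball] at hs ⊢
  obtain ⟨ε, hε, hs⟩ := hs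
  have hc : Continuous f := continuous_iff_continuousAt.2 fun t => (hf t).continuousAt
  refine ⟨ε, hε, fun t ht htne => ?_⟩
  rw [mem_ball, Real.dist_eq, abs_lt] at ht
  have key : ∀ ξ, ξ ∈ ball t₀ ε → ξ ≠ t₀ → f t = f' ξ * (t - t₀) →
      0 < s * f t * (t - t₀) := by
    intro ξ hξ hξne he
    have h1 : 0 < s * f' ξ * (t - t₀) ^ 2 :=
      mul_pos (hs ξ hξ hξne) (sq_pos_of_ne_zero (sub_ne_zero.2 htne))
    rw [he]
    linarith
  rcases lt_or_gt_of_ne (show t ≠ t₀ from htne) with h | h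
  · obtain ⟨ξ, hξ, he⟩ := exists_hasDerivAt_eq_slope f f' h hc.continuousOn fun t _ => hf t
    refine key ξ ?_ hξ.2.ne ?_
    · rw [mem_ball, Real.dist_eq, abs_lt]
      constructor <;> linarith [hξ.1, hξ.2]
    · rw [he, h0]
      field_simp [sub_ne_zero.2 h.ne']
      ring
  · obtain ⟨ξ, hξ, he⟩ := exists_hasDerivAt_eq_slope f f' h hc.continuousOn fun t _ => hf t
    refine key ξ ?_ hξ.1.ne' ?_
    · rw [mem_ball, Real.dist_eq, abs_lt]
      constructor <;> linarith [hξ.1, hξ.2]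
    · rw [he, h0]
      field_simp [sub_ne_zero.2 h.ne']
      ring

/-- A zero `b = 1` of `G (0, b)` at which the sign changes persists as a zero of `G (σ, b)` for
small `σ`. -/
theorem eventually_exists_zero {G : ℝ × ℝ → ℝ} (hG : Continuous G) {s : ℝ}
    (hs : ∀ᶠ b in 𝓝[≠] (1 : ℝ), 0 < s * G (0, b) * (b - 1)) {ε : ℝ} (hε : 0 < ε) :
    ∀ᶠ σ in 𝓝 (0 : ℝ), ∃ b ∈ Ioo (1 - ε) (1 + ε), G (σ, b) = 0 := by
  have hr : ∀ᶠ b in 𝓝[>] (1 : ℝ), 0 < s * G (0, b) * (b - 1) :=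
    hs.filter_mono (nhdsWithin_mono _ fun b hb => ne_of_gt hb)
  have hl : ∀ᶠ b in 𝓝[<] (1 : ℝ), 0 < s * G (0, b) * (b - 1) :=
    hs.filter_mono (nhdsWithin_mono _ fun b hb => ne_of_lt hb)
  obtain ⟨b₁, h1, hb₁⟩ := (hl.and (Ioo_mem_nhdsLT (show 1 - ε < 1 by linarith))).exists
  obtain ⟨b₂, h2, hb₂⟩ := (hr.and (Ioo_mem_nhdsGT (show 1 < 1 + ε by linarith))).exists
  have h1' : s * G (0, b₁) < 0 := by
    by_contra! hc
    exact absurd h1 (not_lt.2 (mul_nonpos_of_nonneg_of_nonpos hc (by linarith [hb₁.2])))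
  have h2' : 0 < s * G (0, b₂) := pos_of_mul_pos_left h2 (by linarith [hb₂.1])
  have hs0 : s ≠ 0 := by
    rintro rfl
    simp at h2'
  have hc : ∀ b, ContinuousAt (fun σ : ℝ => s * G (σ, b)) 0 := fun b => by
    have : Continuous (fun σ : ℝ => s * G (σ, b)) :=
      continuous_const.mul (hG.comp (by fun_prop))
    exact this.continuousAt
  filter_upwards [(hc b₁).eventually (gt_mem_nhds h1'), (hc b₂).eventually (lt_mem_nhds h2')]
    with σ h3 h4
  have hcσ : Continuous fun b : ℝ => s * G (σ, b) := continuous_const.mul (hG.comp (by fun_prop))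
  obtain ⟨b, hb, hb0⟩ := intermediate_value_Icc (hb₁.2.trans hb₂.1).le hcσ.continuousOn
    (show (0 : ℝ) ∈ Icc (s * G (σ, b₁)) (s * G (σ, b₂)) from ⟨h3.le, h4.le⟩)
  exact ⟨b, ⟨by linarith [hb.1, hb₁.1], by linarith [hb.2, hb₂.2]⟩,
    (mul_eq_zero.1 hb0).resolve_left hs0⟩

/-- The value at `z = (σ, b)` of the Jacobi field whose vanishing characterizes the conjugate
covectors, in the coordinates of `covector`. -/
noncomputable def jacobi (X U : ℝ → ℝ) (z : ℝ × ℝ) : ℝ :=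
  U (-(X 0 * z.1)) * X (z.2 + -(X 0 * z.1)) -
    U (z.2 + -(X 0 * z.1)) * (X (-(X 0 * z.1)) + z.2 * U (-(X 0 * z.1)))

theorem IsSolution.continuous_jacobi (h : IsSolution α v X U Y) : Continuous (jacobi X U) := by
  have h1 := h.continuous_X
  have h2 := h.continuous_U
  unfold jacobi
  fun_prop

/-- If the Jacobi field changes sign at `b = 1`, the initial covector is a limit of conjugate
covectors of nearby parameters `σ ≠ 0`. By `hne`, these have a component `dx` and their geodesics do
not end on the singular line. -/
theorem IsSolution.frequently_mem (hα : 1 ≤ α) (h : IsSolution α v X U Y) (hv : v ≠ 0)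
    (h0 : X 0 ≠ 0) {s : ℝ}
    (hs : ∀ᶠ b in 𝓝[≠] (1 : ℝ), 0 < s * jacobi X U (0, b) * (b - 1))
    (hne : ∀ᶠ z in 𝓝 ((0 : ℝ), (1 : ℝ)), z.1 ≠ 0 → jacobi X U z = 0 →
      U (-(X 0 * z.1)) ≠ 0 ∧ X (z.2 + -(X 0 * z.1)) ≠ 0) :
    ∃ᶠ p in 𝓝 (U 0, v), p ∈ SubRiem.nontrivialConjugateLocus (SubRiem.grushin α) (X 0, Y 0) ∧
      p.1 ≠ 0 ∧ (SubRiem.expMap (SubRiem.grushin α) (X 0, Y 0) p).1 ≠ 0 := by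
  obtain ⟨a, ha⟩ := h.exists_isFamily
  rw [frequently_iff]
  intro V hV
  have hcont : ContinuousAt (covector α v X U a) (0, 1) := ha.smoothNear_covector.continuousAt
  rw [← covector_base ha] at hV
  have hb0 : ∀ᶠ z in 𝓝 ((0 : ℝ), (1 : ℝ)), z.2 ≠ 0 :=
    continuous_snd.continuousAt.eventually_ne (by simp)
  have hall := (((hcont.eventually hV).and hne).and hb0).and
    ((eventually_fst ha.eventually_pos 1).and (eventually_fst ha.mul_eq 1))
  obtain ⟨ε, hε, hball⟩ := Metric.eventually_nhds_iff_ball.1 hall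
  have hσ : ∀ᶠ σ in 𝓝[≠] (0 : ℝ), (∃ b ∈ Ioo (1 - ε) (1 + ε), jacobi X U (σ, b) = 0) ∧
      |σ| < ε ∧ σ ≠ 0 := by
    have h1 : ∀ᶠ σ in 𝓝 (0 : ℝ), |σ| < ε :=
      continuous_abs.continuousAt.eventually (gt_mem_nhds (by simpa using hε))
    filter_upwards [(eventually_exists_zero h.continuous_jacobi hs hε).filter_mono
      nhdsWithin_le_nhds, h1.filter_mono nhdsWithin_le_nhds, self_mem_nhdsWithin] with σ h2 h3 h4
    exact ⟨h2, h3, h4⟩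
  obtain ⟨σ, ⟨b, hb, hJ⟩, hσε, hσ0⟩ := hσ.exists
  have hz : ((σ, b) : ℝ × ℝ) ∈ ball ((0 : ℝ), (1 : ℝ)) ε := by
    rw [mem_ball, Prod.dist_eq, max_lt_iff, Real.dist_eq, Real.dist_eq, sub_zero,
      abs_lt (a := b - 1)]
    exact ⟨hσε, by linarith [hb.1], by linarith [hb.2]⟩
  obtain ⟨⟨⟨hzV, hz1⟩, hzb⟩, hpos, hmul⟩ := hball _ hz
  obtain ⟨hz2, hz3⟩ := hz1 hσ0 hJ
  simp only at hzb hpos hmul hz2 hz3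
  refine ⟨_, hzV, ?_, ?_, ?_⟩
  · have h5 := h.rescale hpos b (-(X 0 * σ)) (Y 0)
    have h6 := h5.mem_nontrivialConjugateLocus_iff hα
    have h8 : a σ ^ (1 - α) ≠ 0 := (Real.rpow_pos_of_pos hpos _).ne'
    have h7 : a σ ^ (1 + α) ≠ 0 := (Real.rpow_pos_of_pos hpos _).ne'
    simp only [mul_zero, zero_add, sub_self, add_zero, mul_one] at h6
    rw [hmul] at h6
    refine h6.2 ⟨by positivity, by positivity, ?_⟩
    simp only [jacobi] at hJ
    linear_combination (a σ ^ 2 * b) * hJ + (a σ * b * U (b + -(X 0 * σ))) * hmul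
  · simp only [covector]
    positivity
  · rw [h.expMap_covector hα hpos hmul]
    simp only [endpoint]
    positivity

/-- A conjugate covector at a point off the singular line, which has no component `dx` or whose
geodesic ends on the singular line, is a limit of conjugate covectors with neither property. -/
theorem IsSolution.frequently_mem_of_eq_zero (hα : 1 ≤ α) (h : IsSolution α v X U Y) (hv : v ≠ 0)
    (h0 : X 0 ≠ 0) (hJ : U 0 * X 1 - U 1 * (X 0 + U 0) = 0) (hbad : U 0 = 0 ∨ X 1 = 0) :
    ∃ᶠ p in 𝓝 (U 0, v), p ∈ SubRiem.nontrivialConjugateLocus (SubRiem.grushin α) (X 0, Y 0) ∧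
      p.1 ≠ 0 ∧ (SubRiem.expMap (SubRiem.grushin α) (X 0, Y 0) p).1 ≠ 0 := by
  have hα0 : 0 < α := by linarith
  have hk : 0 < α * v ^ 2 := by positivity
  have hshift : Tendsto (fun z : ℝ × ℝ => -(X 0 * z.1)) (𝓝 (0, 1)) (𝓝 0) := by
    have : Continuous fun z : ℝ × ℝ => -(X 0 * z.1) := by fun_prop
    simpa using this.tendsto (0, 1)
  have hend : Tendsto (fun z : ℝ × ℝ => z.2 + -(X 0 * z.1)) (𝓝 (0, 1)) (𝓝 1) := by
    have : Continuous fun z : ℝ × ℝ => z.2 + -(X 0 * z.1) := by fun_prop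
    simpa using this.tendsto (0, 1)
  have hshift_ne : ∀ z : ℝ × ℝ, z.1 ≠ 0 → -(X 0 * z.1) ≠ 0 := fun z hz =>
    neg_ne_zero.2 (mul_ne_zero h0 hz)
  have hxf : ∀ x : ℝ, x ≠ 0 → 0 < x * force α x := fun x hx => by
    rw [mul_force hα]
    exact Real.rpow_pos_of_pos (abs_pos.2 hx) _
  by_cases hU0 : U 0 = 0
  -- both ends are turning points of the solution; `jacobi` is a multiple of `U` when `σ = 0`
  · have hU1 : U 1 = 0 := by
      rw [hU0, zero_mul, add_zero, zero_sub, neg_eq_zero] at hJ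
      exact (mul_eq_zero.1 hJ).resolve_right h0
    have hX1 : X 1 ≠ 0 := by
      intro hX1
      have he := h.energy hα 1 0
      rw [hU0, hU1, hX1, abs_zero, Real.zero_rpow (by linarith)] at he
      have : 0 < v ^ 2 * |X 0| ^ (2 * α) := by positivity
      linarith
    have hX1' : ∀ᶠ b in 𝓝 (1 : ℝ), 0 < X 1 * X b := by
      have : ContinuousAt (fun b => X 1 * X b) 1 :=
        (continuous_const.mul h.continuous_X).continuousAt
      exact this.eventually (lt_mem_nhds (mul_self_pos.2 hX1))
    refine h.frequently_mem hα hv h0 (s := X 0 * X 1) ?_ ?_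
    · have h1 := eventually_mul_sub_pos h.hasDerivAt_U (t₀ := 1) (s := -X 1) hU1 (by
        filter_upwards [hX1'.filter_mono nhdsWithin_le_nhds] with b hb
        have h2 : X b ≠ 0 := by
          rintro h2
          simp [h2] at hb
        have h3 : 0 < X b ^ 2 := by positivity
        refine (mul_pos_iff_of_pos_left h3).1 ?_
        have h4 := mul_pos hk (mul_pos hb (hxf _ h2))
        linarith)
      filter_upwards [h1] with b hb
      have h5 : jacobi X U (0, b) = -(U b * X 0) := by simp [jacobi, hU0]
      rw [h5]
      have h6 : 0 < X 0 ^ 2 := by positivity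
      have h7 := mul_pos h6 hb
      linarith
    · have h1 : ∀ᶠ c in 𝓝 (0 : ℝ), c ≠ 0 → U c ≠ 0 := by
        have := (h.hasDerivAt_U 0).eventually_ne (c := 0)
          (neg_ne_zero.2 (mul_ne_zero hk.ne' (force_ne_zero h0)))
        exact eventually_nhdsWithin_iff.1 this
      filter_upwards [hshift.eventually h1, hend.eventually hX1'] with z h2 h3 hz _
      refine ⟨h2 (hshift_ne z hz), fun h4 => ?_⟩
      simp [h4] at h3
  -- the geodesic ends on the singular line; the derivative of `jacobi` in `b` vanishes at `b = 1`,
  -- but has the same sign on both sides because `X` changes sign with `b - 1`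
  · have hX1 : X 1 = 0 := hbad.resolve_left hU0
    have hU1 : U 1 ≠ 0 := by
      intro hU1
      have he := h.energy hα 1 0
      rw [hX1, hU1, abs_zero, Real.zero_rpow (by linarith)] at he
      have : 0 < U 0 ^ 2 + v ^ 2 * |X 0| ^ (2 * α) := by positivity
      linarith
    have hXU : X 0 + U 0 = 0 := by
      rw [hX1, mul_zero, zero_sub, neg_eq_zero] at hJ
      exact (mul_eq_zero.1 hJ).resolve_left hU1
    have hX : ∀ᶠ b in 𝓝[≠] (1 : ℝ), 0 < U 1 * X b * (b - 1) :=
      eventually_mul_sub_pos h.hasDerivAt_X hX1 (by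
        have : ContinuousAt (fun b => U 1 * U b) 1 :=
          (continuous_const.mul h.continuous_U).continuousAt
        exact (this.eventually (lt_mem_nhds (mul_self_pos.2 hU1))).filter_mono nhdsWithin_le_nhds)
    refine h.frequently_mem hα hv h0 (s := U 0 * U 1) ?_ ?_
    · have hd : ∀ b, HasDerivAt (fun b => X b + U b * (1 - b))
          (α * v ^ 2 * force α (X b) * (b - 1)) b := fun b =>
        ((h.hasDerivAt_X b).add ((h.hasDerivAt_U b).mul
          ((hasDerivAt_id b).const_sub 1))).congr_deriv (by simp; ring)
      have h1 := eventually_mul_sub_pos hd (t₀ := 1) (s := U 1) (by simp [hX1]) (by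
        filter_upwards [hX] with b hb
        have h2 : X b ≠ 0 := by
          rintro h2
          simp [h2] at hb
        have h3 : 0 < X b ^ 2 := by positivity
        refine (mul_pos_iff_of_pos_left h3).1 ?_
        have h4 := mul_pos hk (mul_pos hb (hxf _ h2))
        linarith)
      filter_upwards [h1] with b hb
      have h5 : jacobi X U (0, b) = U 0 * (X b + U b * (1 - b)) := by
        simp only [jacobi, mul_zero, neg_zero, add_zero]
        linear_combination (-U b) * hXU
      rw [h5]
      have h6 : 0 < U 0 ^ 2 := by positivity
      have h7 := mul_pos h6 hb
      linarith
    · have hU0' : ∀ᶠ c in 𝓝 (0 : ℝ), U c ≠ 0 :=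
        h.continuous_U.continuousAt.eventually_ne hU0
      have hr : ∀ᶠ c in 𝓝 (0 : ℝ), c ≠ 0 → X c + (1 - c) * U c ≠ 0 := by
        have hd : HasDerivAt (fun c => X c + (1 - c) * U c) (-(α * v ^ 2 * force α (X 0))) 0 :=
          ((h.hasDerivAt_X 0).add (((hasDerivAt_id (0 : ℝ)).const_sub 1).mul
            (h.hasDerivAt_U 0))).congr_deriv (by simp)
        exact eventually_nhdsWithin_iff.1 (hd.eventually_ne (c := 0)
          (neg_ne_zero.2 (mul_ne_zero hk.ne' (force_ne_zero h0))))
      have hX' : ∀ᶠ b in 𝓝 (1 : ℝ), b ≠ 1 → X b ≠ 0 := by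
        filter_upwards [eventually_nhdsWithin_iff.1 hX] with b hb hb1 hb0
        have := hb hb1
        simp [hb0] at this
      filter_upwards [hshift.eventually hU0', hshift.eventually hr, hend.eventually hX']
        with z h2 h3 h4 hz hJz
      refine ⟨h2, fun h5 => ?_⟩
      have h6 : z.2 + -(X 0 * z.1) = 1 := by
        by_contra h6
        exact h4 h6 h5
      have h7 : z.2 = 1 - -(X 0 * z.1) := by linarith
      rw [jacobi, h6, hX1, h7, mul_zero, zero_sub, neg_eq_zero] at hJz
      exact mul_ne_zero hU1 (h3 (hshift_ne z hz)) hJz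

end locus

/-! ### Existence of conjugate covectors -/

section existence

variable {α v : ℝ} {X U Y : ℝ → ℝ}

theorem IsSolution.neg (h : IsSolution α v X U Y) :
    IsSolution α v (fun t => -X t) (fun t => -U t) Y := by
  refine ⟨fun t => (h.hasDerivAt_X t).neg, fun t => ?_, fun t => ?_⟩
  · refine (h.hasDerivAt_U t).neg.congr_deriv ?_
    rw [force_neg]
    ring
  · simpa using h.hasDerivAt_Y t

/-- A solution is symmetric about a turning time (`ε = 1`), and antisymmetric about a time at which
it meets the singular line (`ε = -1`). -/
theorem IsSolution.reflect (hα : 1 ≤ α) (h : IsSolution α v X U Y) {ε τ : ℝ}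
    (hε : ε = 1 ∨ ε = -1) (hX : X τ = ε * X τ) (hU : U τ = -(ε * U τ)) {s : ℝ} (hs : 0 ≤ s) :
    X (τ + s) = ε * X (τ - s) ∧ U (τ + s) = -(ε * U (τ - s)) := by
  have hf : ∀ x, force α (ε * x) = ε * force α x := by
    rcases hε with rfl | rfl
    · simp
    · simp [force_neg]
  have hp : ∀ t : ℝ, HasDerivAt (fun t => τ + t) 1 t := fun t => (hasDerivAt_id t).const_add τ
  have hm : ∀ t : ℝ, HasDerivAt (fun t => τ - t) (-1) t := fun t => (hasDerivAt_id t).const_sub τ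
  have key := eqOn_of_solution (contDiff_planarField hα v) (T := s)
    (γ := fun t => (X (τ + t), U (τ + t))) (δ := fun t => (ε * X (τ - t), -(ε * U (τ - t))))
    (fun t _ => by
      refine HasDerivAt.hasDerivWithinAt ?_
      exact (((h.hasDerivAt_X _).comp t (hp t)).prodMk
        ((h.hasDerivAt_U _).comp t (hp t))).congr_deriv (by simp))
    (fun t _ => by
      refine HasDerivAt.hasDerivWithinAt ?_
      refine ((((h.hasDerivAt_X _).comp t (hm t)).const_mul ε).prodMk
        (((h.hasDerivAt_U _).comp t (hm t)).const_mul ε).neg).congr_deriv ?_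
      simp only [hf, Prod.mk.injEq]
      constructor <;> ring)
    (by simp [← hX, ← hU]) (right_mem_Icc.2 hs)
  exact ⟨congrArg Prod.fst key, congrArg Prod.snd key⟩

/-- A solution starting vertically off the singular line meets this line: while `X` is positive it
is concave, and its slope becomes negative. -/
theorem IsSolution.exists_zero_of_pos (hα : 1 ≤ α) (hv : v ≠ 0) (h : IsSolution α v X U Y)
    (hU : U 0 = 0) (hX : 0 < X 0) : ∃ t > 0, X t = 0 := by
  by_contra! hne
  have hα0 : 0 < α := by linarith
  have hpos : ∀ t, 0 ≤ t → 0 < X t := by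
    intro t ht
    by_contra! hc
    obtain ⟨s, hs, hs0⟩ := intermediate_value_Icc' ht h.continuous_X.continuousOn
      (show (0 : ℝ) ∈ Icc (X t) (X 0) from ⟨hc, hX.le⟩)
    rcases hs.1.eq_or_lt with rfl | hs1
    · exact hX.ne' hs0
    · exact hne s hs1 hs0
  have hanti : StrictAntiOn U (Ici 0) := by
    refine strictAntiOn_of_deriv_neg (convex_Ici 0) h.continuous_U.continuousOn fun t ht => ?_
    rw [interior_Ici] at ht
    rw [(h.hasDerivAt_U t).deriv, neg_lt_zero]
    have := force_pos (α := α) (hpos t (le_of_lt ht))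
    positivity
  have hU1 : U 1 < 0 := by
    rw [← hU]
    exact hanti self_mem_Ici (mem_Ici.2 zero_le_one) one_pos
  have hXle : ∀ t, 1 < t → X t < X 1 + U 1 * (t - 1) := by
    intro t ht
    obtain ⟨ξ, hξ, he⟩ := exists_hasDerivAt_eq_slope X U ht h.continuous_X.continuousOn
      fun t _ => h.hasDerivAt_X t
    have h1 : U ξ < U 1 :=
      hanti (mem_Ici.2 zero_le_one) (mem_Ici.2 (by linarith [hξ.1])) hξ.1
    rw [he, div_lt_iff₀ (by linarith)] at h1
    linarith
  have hX1 := hpos 1 zero_le_one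
  -- the tangent at time `1` meets the singular line at this time
  have ht : 1 < 1 + X 1 / -U 1 := by
    have : 0 < X 1 / -U 1 := div_pos hX1 (by linarith)
    linarith
  have h1 := hXle _ ht
  have h2 : U 1 * (1 + X 1 / -U 1 - 1) = -X 1 := by
    field_simp [hU1.ne]
    ring
  rw [h2] at h1
  linarith [hpos _ (by linarith : (0 : ℝ) ≤ 1 + X 1 / -U 1)]

theorem IsSolution.exists_zero (hα : 1 ≤ α) (hv : v ≠ 0) (h : IsSolution α v X U Y)
    (hU : U 0 = 0) (hX : X 0 ≠ 0) : ∃ t > 0, X t = 0 := by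
  rcases lt_or_gt_of_ne hX with hX | hX
  · obtain ⟨t, ht, h0⟩ := h.neg.exists_zero_of_pos hα hv (by simp [hU]) (by simpa using hX)
    exact ⟨t, ht, neg_eq_zero.1 h0⟩
  · exact h.exists_zero_of_pos hα hv hU hX

/-- Off the singular line, the geodesic starting vertically has a conjugate point after half a
period. -/
theorem nonempty_nontrivialConjugateLocus_of_ne_zero (hα : 1 ≤ α) {q : ℝ × ℝ} (hq : q.1 ≠ 0) :
    (SubRiem.nontrivialConjugateLocus (SubRiem.grushin α) q).Nonempty := by
  obtain ⟨X, U, Y, h, hX0, hU0, -⟩ := exists_isSolution hα 1 q.1 0 0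
  have hX0' : X 0 ≠ 0 := hX0 ▸ hq
  obtain ⟨τ, hτ, hXτ⟩ := h.exists_zero hα one_ne_zero hU0 hX0'
  have hU : U (2 * τ) = 0 := by
    have := (h.reflect hα (ε := -1) (τ := τ) (.inr rfl) (by simp [hXτ]) (by simp) hτ.le).2
    rw [sub_self, hU0] at this
    rw [two_mul, this]
    simp
  have h1 := (h.rescale one_pos (2 * τ) 0 q.2).mem_nontrivialConjugateLocus_iff hα
  simp only [mul_zero, add_zero, sub_self, one_mul, mul_one, Real.one_rpow, hX0, hU0, hU,
    zero_mul] at h1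
  exact ⟨_, h1.2 ⟨by positivity, by positivity, by simp⟩⟩

/-- From the singular line, a conjugate time lies between the first two turning times. The time `τ`
of the first passage of a solution starting vertically from `x = 1` is the quarter of its period.
-/
theorem nonempty_nontrivialConjugateLocus_of_eq_zero (hα : 1 ≤ α) {q : ℝ × ℝ} (hq : q.1 = 0) :
    (SubRiem.nontrivialConjugateLocus (SubRiem.grushin α) q).Nonempty := by
  obtain ⟨X, U, Y, h, hX0, hU0, -⟩ := exists_isSolution hα 1 1 0 0
  obtain ⟨τ, hτ, hXτ⟩ := h.exists_zero hα one_ne_zero hU0 (by simp [hX0])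
  have h2 : X (2 * τ) = -1 ∧ U (2 * τ) = 0 := by
    have := h.reflect hα (ε := -1) (τ := τ) (.inr rfl) (by simp [hXτ]) (by simp) hτ.le
    rw [sub_self, hU0, hX0] at this
    rw [two_mul]
    simpa using this
  have h4 : X (4 * τ) = 1 ∧ U (4 * τ) = 0 := by
    have := h.reflect hα (ε := 1) (τ := 2 * τ) (.inl rfl) (by simp) (by simp [h2.2])
      (s := 2 * τ) (by positivity)
    rw [sub_self, hU0, hX0] at this
    rw [show 4 * τ = 2 * τ + 2 * τ by ring]
    simpa using this
  have hUτ : U τ ≠ 0 := by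
    intro hUτ
    have := h.energy hα τ 0
    rw [hUτ, hXτ, hU0, hX0, abs_zero, Real.zero_rpow (by linarith)] at this
    simp at this
  have hc : Continuous fun b => X (b + τ) - b * U (b + τ) := by
    have h1 := h.continuous_X
    have h2 := h.continuous_U
    fun_prop
  -- the geodesic is the solution from time `τ` on, and `b` is its duration
  obtain ⟨b, hb, hb0⟩ := intermediate_value_Icc (show τ ≤ 3 * τ by linarith) hc.continuousOn
    (show (0 : ℝ) ∈ Icc _ _ from by
      simp only [show τ + τ = 2 * τ by ring, show 3 * τ + τ = 4 * τ by ring, h2.1, h2.2, h4.1, h4.2]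
      norm_num)
  have hbpos : 0 < b := by linarith [hb.1]
  have h1 := (h.rescale one_pos b τ q.2).mem_nontrivialConjugateLocus_iff hα
  have hq' : ((0 : ℝ), q.2) = q := by rw [← hq]
  simp only [mul_zero, add_zero, zero_add, sub_self, one_mul, mul_one, Real.one_rpow, hXτ,
    hq'] at h1
  refine ⟨_, h1.2 ⟨by positivity, by positivity, ?_⟩⟩
  linear_combination (b * U τ) * hb0

theorem nonempty_nontrivialConjugateLocus (hα : 1 ≤ α) (q : ℝ × ℝ) :
    (SubRiem.nontrivialConjugateLocus (SubRiem.grushin α) q).Nonempty := by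
  by_cases hq : q.1 = 0
  · exact nonempty_nontrivialConjugateLocus_of_eq_zero hα hq
  · exact nonempty_nontrivialConjugateLocus_of_ne_zero hα hq

end existence

/-! ### The generic conjugate covectors -/

/-- The interior of the set of covectors with a non-zero component `dx`, whose geodesics do not end
on the singular line. -/
def regularCovectors (α : ℝ) (q : ℝ × ℝ) : Set (ℝ × ℝ) :=
  {p | ∀ᶠ p' in 𝓝 p, p'.1 ≠ 0 ∧ (SubRiem.expMap (SubRiem.grushin α) q p').1 ≠ 0}

/-- The exponential map is continuous at conjugate covectors, so that these are interior. -/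
theorem mem_regularCovectors {α : ℝ} (hα : 1 ≤ α) {q p : ℝ × ℝ}
    (hp : p ∈ SubRiem.nontrivialConjugateLocus (SubRiem.grushin α) q) (h1 : p.1 ≠ 0)
    (h2 : (SubRiem.expMap (SubRiem.grushin α) q p).1 ≠ 0) : p ∈ regularCovectors α q := by
  obtain ⟨x, y⟩ := q
  obtain ⟨u, v⟩ := p
  obtain ⟨X, U, Y, h, rfl, rfl, rfl⟩ := exists_isSolution hα v x u y
  obtain ⟨hv, he, -⟩ := (h.mem_nontrivialConjugateLocus_iff hα).1 hp
  have hc := (h.hasFDerivAt_expMap hα hv he).1.continuousAt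
  exact (continuousAt_fst.eventually_ne h1).and (hc.fst.eventually_ne h2)

theorem nontrivialConjugateLocus_subset_closure {α : ℝ} (hα : 1 ≤ α) (q : ℝ × ℝ) :
    SubRiem.nontrivialConjugateLocus (SubRiem.grushin α) q ⊆
      closure (regularCovectors α q ∩
        SubRiem.nontrivialConjugateLocus (SubRiem.grushin α) q) := by
  intro p hp
  by_cases hgood : p.1 ≠ 0 ∧ (SubRiem.expMap (SubRiem.grushin α) q p).1 ≠ 0
  · exact subset_closure ⟨mem_regularCovectors hα hp hgood.1 hgood.2, hp⟩
  obtain ⟨x, y⟩ := q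
  obtain ⟨u, v⟩ := p
  obtain ⟨X, U, Y, h, rfl, rfl, rfl⟩ := exists_isSolution hα v x u y
  obtain ⟨hv, he, hJ⟩ := (h.mem_nontrivialConjugateLocus_iff hα).1 hp
  have hbad : U 0 = 0 ∨ X 1 = 0 := by
    rw [h.expMap_eq hα] at hgood
    by_contra! hc
    exact hgood hc
  -- from the singular line, `U 0 = 0` or `X 1 = 0` would imply that the energy is zero
  have h0 : X 0 ≠ 0 := by
    intro h0
    have hz : (0 : ℝ) ^ (2 * α) = 0 := Real.zero_rpow (by linarith)
    have hU0 : U 0 ≠ 0 := by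
      intro hU0
      simp [hU0, h0, hz] at he
    have hX1 := hbad.resolve_left hU0
    have hU1 : U 1 = 0 := by
      rw [hX1, h0, mul_zero, zero_add, zero_sub, neg_eq_zero] at hJ
      exact (mul_eq_zero.1 hJ).resolve_right hU0
    refine he ((h.energy hα 0 1).trans ?_)
    simp [hX1, hU1, hz]
  rw [mem_closure_iff_frequently]
  exact (h.frequently_mem_of_eq_zero hα hv h0 hJ hbad).mono fun p' hp' =>
    ⟨mem_regularCovectors hα hp'.1 hp'.2.1 hp'.2.2, hp'.1⟩

theorem exists_foldCriterion {α : ℝ} (hα : 1 ≤ α) {q p : ℝ × ℝ}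
    (hp : p ∈ regularCovectors α q ∩ SubRiem.nontrivialConjugateLocus (SubRiem.grushin α) q) :
    ∃ k, FoldCriterion (SubRiem.expMap (SubRiem.grushin α) q) p k := by
  have hreg : p.1 ≠ 0 ∧ (SubRiem.expMap (SubRiem.grushin α) q p).1 ≠ 0 := hp.1.self_of_nhds
  obtain ⟨x, y⟩ := q
  obtain ⟨u, v⟩ := p
  obtain ⟨X, U, Y, h, rfl, rfl, rfl⟩ := exists_isSolution hα v x u y
  obtain ⟨hv, -, hJ⟩ := (h.mem_nontrivialConjugateLocus_iff hα).1 hp.2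
  rw [h.expMap_eq hα] at hreg
  exact h.foldCriterion hα hv hreg.1 hreg.2 hJ

end Grushin

theorem mainTheorem1 (α : ℝ) (hα : 1 ≤ α) (q : ℝ × ℝ) :
    ∃ C₀ : Set (ℝ × ℝ),
      C₀.Nonempty ∧
      (∃ O : Set (ℝ × ℝ), IsOpen O ∧
        C₀ = O ∩ SubRiem.nontrivialConjugateLocus (SubRiem.grushin α) q) ∧
      SubRiem.nontrivialConjugateLocus (SubRiem.grushin α) q ⊆ closure C₀ ∧
      ∀ p ∈ C₀,
        SubRiem.IsFoldSingularity (SubRiem.expMap (SubRiem.grushin α) q) p ∧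
        SubRiem.IsEquivalentNear (SubRiem.expMap (SubRiem.grushin α) q) p
          (fun z => (z.1 ^ 2, z.2)) := by
  have hsub := Grushin.nontrivialConjugateLocus_subset_closure hα q
  refine ⟨_, ?_, ⟨Grushin.regularCovectors α q, isOpen_setOfPred_eventually_nhds, rfl⟩, hsub,
    fun p hp => ?_⟩
  · exact closure_nonempty_iff.1 ((Grushin.nonempty_nontrivialConjugateLocus hα q).mono hsub)
  · obtain ⟨k, hk⟩ := Grushin.exists_foldCriterion hα hp
    exact ⟨hk.isFoldSingularity, hk.isEquivalentNear⟩
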